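/- **Setting.** The situation calculus (sorts object, action, situation; $S_0$, $do$, $\sqsubset$, $Poss$; relational and functional fluents with object arguments and a situation argument) is extended with counting terms $\#\bar y.\varphi$ and transitive closure formulas $[TC_{\bar x,\bar y}\varphi](\bar u,\bar v)$ (reflexive transitive closure); the values of counting terms are distinguished objects. Fluent formulas quantify over objects, $\phi[s]$ denotes a situation-suppressed formula $\phi$ evaluated in $s$, and rigid (situation-independent) symbols and the object domain are shared by the high level (HL) and the low level (LL). A basic action theory (BAT) $\mathcal D$ consists of the foundational axioms for situations (including second-order induction), unique name axioms for the action functions, precondition axioms $Poss(A(\vec x),s)\equiv\Pi_A(\vec x,s)$, successor state axioms (SSAs) $P(\vec y,do(a,s))\equiv\phi_P(\vec y,a,s)$ and $f(\vec y,do(a,s))=z\equiv\psi_f(\vec y,z,a,s)$, and an initial knowledge base $\mathcal D^{S_0}$ about $S_0$. Put $Exec(s)\doteq\forall a,s'.\,do(a,s')\sqsubseteq s\supset Poss(a,s')$. A *state constraint* of $\mathcal D$ is a $\phi$ with $\mathcal D\models\forall s.\,Exec(s)\supset\phi[s]$. Golog programs $\delta::=\alpha\mid\varphi?\mid\delta_1;\delta_2\mid\delta_1|\delta_2\mid\pi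 x.\delta\mid\delta^*$ have the usual $Trans$/$Final$ semantics, and $Do(\delta,s,s')\doteq\exists\delta'.\,Trans^*(\delta,s,\delta',s')\wedge Final(\delta',s')$. An infinite history $h$ is an infinite sequence of situations starting in $S_0$, each of the form $do(a,s)$ with $s$ its predecessor; $s\sqsubset h$ means that $s$ occurs in it. A generalized planning problem is $\mathcal G=\langle\mathcal D,C,G\rangle$ with a BAT $\mathcal D$, a trajectory constraint $C$ (a formula whose only free variable is an infinite history) and a closed goal condition $G$. $Term(\delta,s,C)$ says that there is no infinite history $h$ with $C(h)$, $s\sqsubset h$, and $\exists\delta'.\,Trans^*(\delta,s,\delta',s')$ for all $s\sqsubseteq s'\sqsubset h$. Let $\mathcal G_h=\langle\mathcal D_h,C_h,G_h\rangle$ (HL) and $\mathcal G_l=\langle\mathcal D_l,C_l,G_l\rangle$ (LL) be generalized planning problems. A refinement mapping $m$ assigns to every HL action $A(\vec x)$ an LL program $m(A(\vec x))$, to every HL relational fluent $P(\vec y)$ an LL formula and to every HL functional fluent $f(\vec y)$ an LL term; $m(\phi)$ replaces the HL symbols of $\phi$ by their definitions. For models $M_h$ of $\mathcal D_h$ and $M_l$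 of $\mathcal D_l$ with the same object domain, $s_h\sim_m s_l$ means that every HL fluent has in $s_h$ the same value as its image under $m$ in $s_l$. A relation $B$ between their situations is an *$m$-simulation* if $\langle S_0^{M_h},S_0^{M_l}\rangle\in B$ and * $\langle s_h,s_l\rangle\in B$ implies: $s_h\sim_m s_l$; for every HL action $A$ and objects $\vec x$, $Term(m(A(\vec x)),s_l,C_l)$; and whenever $Do(m(A(\vec x)),s_l,s_l')$, there is $s_h'$ with $Do(A(\vec x),s_h,s_h')$ and $\langle s_h',s_l'\rangle\in B$; * for every infinite sequence $\sigma$ of ground HL actions, if some infinite history of $M_l$ generated by $m(\sigma)$ satisfies $C_l$, then some infinite history of $M_h$ generated by $\sigma$ satisfies $C_h$. Here $h$ is generated by a sequence $\delta_0,\delta_1,\dots$ of programs if there are $t_0=S_0,t_1,t_2,\dots\sqsubset h$ with $Do(\delta_i,t_i,t_{i+1})$ for all $i$. An *$m$-back-simulation* is defined in the same way, with the last requirement of the first item and the second item taken from $M_h$ to $M_l$. $\mathcal G_h$ is a *sound $m$-abstraction* of $\mathcal G_l$ if for every model $M_l$ of $\mathcal D_l$ there are a model $M_h$ of $\mathcal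 D_h$ and an $m$-back-simulation $B$, and also a model $M_h$ of $\mathcal D_h$ and an $m$-simulation $B$, such that in both cases, for all $\langle s_h,s_l\rangle\in B$, if $G_h$ holds in $s_h$ then $G_l$ holds in $s_l$. For LL programs $\delta$ without iteration the extended regressions are defined by $\mathcal R^E[\phi(s),\alpha]=\mathcal R[Poss(\alpha,s)\wedge\phi(do(\alpha,s))]$, $\mathcal R^E[\phi(s),\psi?]=\psi[s]\wedge\phi(s)$, $\mathcal R^E[\phi(s),\delta_1;\delta_2]=\mathcal R^E[\mathcal R^E[\phi(s),\delta_2],\delta_1]$, $\mathcal R^E[\phi(s),\delta_1|\delta_2]=\mathcal R^E[\phi(s),\delta_1]\vee\mathcal R^E[\phi(s),\delta_2]$, $\mathcal R^E[\phi(s),\pi x.\delta]=\exists x.\,\mathcal R^E[\phi(s),\delta]$, where $\mathcal R$ is one-step regression by the precondition and successor state axioms of $\mathcal D_l$, simplified by the unique name axioms; $\mathcal R^U$ is obtained by replacing $\mathcal R^E,\wedge,\vee,\exists$ by $\mathcal R^U,\supset,\wedge,\forall$. Let $pre(\delta,s)=\mathcal R^E[\top(s),\delta]$. Let $\phi_{P,A}(\vec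 x,\vec y,s)$ and $\psi_{f,A}(\vec x,\vec y,z,s)$ be $\phi_P(\vec y,A(\vec x),s)$ and $\psi_f(\vec y,z,A(\vec x),s)$ simplified by the unique name axioms. Put $$\xi_A=\bigwedge_A\forall\vec x.\;pre(m(A(\vec x)),s)\equiv m(\Pi_A(\vec x,s)),$$ $$\zeta_P=\bigwedge_A\forall\vec x.\;pre(m(A(\vec x)),s)\supset\bigwedge_P\forall\vec y.\,\big[\mathcal R^E[m(P(\vec y))[s],m(A(\vec x))]\supset m(\phi_{P,A})\big]\wedge\big[m(\phi_{P,A})\supset\mathcal R^U[m(P(\vec y))[s],m(A(\vec x))]\big],$$ $$\zeta_f=\bigwedge_A\forall\vec x.\;pre(m(A(\vec x)),s)\supset\bigwedge_f\forall\vec y,z.\,\big[\mathcal R^E[m(f(\vec y)=z)[s],m(A(\vec x))]\supset m(\psi_{f,A})\big]\wedge\big[m(\psi_{f,A})\supset\mathcal R^U[m(f(\vec y)=z)[s],m(A(\vec x))]\big],$$ where $A$, $P$, $f$ range over the HL actions, relational fluents and functional fluents. $\models_{fo}$ denotes truth in all first-order structures (with the standard meaning of counting and $TC$, and without the axioms of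 the BATs). **Corollary.** Suppose that all HL actions are deterministic (that is, they are the primitive action functions of $\mathcal D_h$), that the programs $m(A(\vec x))$ contain no iteration, that the trajectory constraints are trivial ($\mathcal D_h\models\forall h.\,C_h(h)$ and $\mathcal D_l\models\forall h.\,C_l(h)$, e.g. $C_h=C_l=\top$), and that $\mathcal D_h$ has the functional fluent consistency property: its unique name axioms and $\mathcal D_h^{S_0}$ entail $\forall a,s,\vec y\,\exists!z.\,\psi_f(\vec y,z,a,s)$ for every HL functional fluent $f$. Let $\mathcal D_{sc}$ be a set of state constraints of $\mathcal D_l$, also used for their conjunction. Then $\mathcal G_h$ is a sound $m$-abstraction of $\mathcal G_l$ if 1. $\mathcal D_l^{S_0}\models_{fo}m(\phi)$ for every $\phi\in\mathcal D_h^{S_0}$; 2. $\models_{fo}\forall s.\,\mathcal D_{sc}(s)\supset\xi_A$; 3. $\models_{fo}\forall s.\,\mathcal D_{sc}(s)\supset\zeta_P\wedge\zeta_f$; 4. $\models_{fo}\forall s.\,\mathcal D_{sc}(s)\wedge m(G_h)[s]\supset G_l[s]$. -/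

import Mathlib

namespace SitCalc

/-! ## Language of the situation calculus with counting and transitive closure -/

/-- The domain dependent vocabulary of a basic action theory: action functions, relational
fluents and functional fluents, with the numbers of their object arguments (the situation argument
of a fluent is not counted). -/
structure Signature where
  Act : Type
  actArity : Act → ℕ
  Rel : Type
  relArity : Rel → ℕ
  Fn : Type
  fnArity : Fn → ℕ

mutual

/-- Situation-suppressed object terms with free object variables in `Fin n` and free action
variables in `Fin k`. `L` is the vocabulary of rigid (situation independent) symbols, and
`count b φ` is the counting term `#y₁…y_b. φ`, whose bound variables are the last `b` ones. -/
inductive Term (L : FirstOrder.Language.{0, 0}) (σ : Signature) (k : ℕ) : ℕ → Type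
  | var {n : ℕ} (i : Fin n) : Term L σ k n
  | func {n j : ℕ} (g : L.Functions j) (ts : Fin j → Term L σ k n) : Term L σ k n
  | fluent {n : ℕ} (f : σ.Fn) (ts : Fin (σ.fnArity f) → Term L σ k n) : Term L σ k n
  | count {n : ℕ} (b : ℕ) (φ : Formula L σ k (n + b)) : Term L σ k n

/-- Situation-suppressed formulas. `actEq i A ts` is `aᵢ = A(ts)` for the `i`-th action variable;
`all b φ` quantifies over the last `b` object variables; `tc c φ us vs` is
`[TC_{x̄,ȳ} φ](us, vs)`, where the `c`-tuples `x̄` and `ȳ` are the last `c + c` variables of `φ`. -/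
inductive Formula (L : FirstOrder.Language.{0, 0}) (σ : Signature) (k : ℕ) : ℕ → Type
  | falsum {n : ℕ} : Formula L σ k n
  | eq {n : ℕ} (t₁ t₂ : Term L σ k n) : Formula L σ k n
  | rigid {n j : ℕ} (R : L.Relations j) (ts : Fin j → Term L σ k n) : Formula L σ k n
  | fluent {n : ℕ} (P : σ.Rel) (ts : Fin (σ.relArity P) → Term L σ k n) : Formula L σ k n
  | actEq {n : ℕ} (i : Fin k) (A : σ.Act) (ts : Fin (σ.actArity A) → Term L σ k n) :
      Formula L σ k n
  | imp {n : ℕ} (φ ψ : Formula L σ k n) : Formula L σ k n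
  | all {n : ℕ} (b : ℕ) (φ : Formula L σ k (n + b)) : Formula L σ k n
  | tc {n : ℕ} (c : ℕ) (φ : Formula L σ k (n + (c + c))) (us vs : Fin c → Term L σ k n) :
      Formula L σ k n

end

variable {L : FirstOrder.Language.{0, 0}} {σ σh σl : Signature} {k n m : ℕ}

namespace Formula

def neg (φ : Formula L σ k n) : Formula L σ k n := φ.imp falsum
def verum : Formula L σ k n := neg falsum
def conj (φ ψ : Formula L σ k n) : Formula L σ k n := neg (φ.imp (neg ψ))
def disj (φ ψ : Formula L σ k n) : Formula L σ k n := (neg φ).imp ψ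
def iff (φ ψ : Formula L σ k n) : Formula L σ k n := conj (φ.imp ψ) (ψ.imp φ)
def ex (b : ℕ) (φ : Formula L σ k (n + b)) : Formula L σ k n := neg (all b (neg φ))

/-- Finite conjunction. -/
def bigConj {j : ℕ} (φs : Fin j → Formula L σ k n) : Formula L σ k n :=
  (List.ofFn φs).foldr conj verum

end Formula

/-! ### Renaming and capture-avoiding substitution of object variables -/

/-- Extension of a renaming under a binder of `b` variables. -/
def liftRen (b : ℕ) (ρ : Fin n → Fin m) : Fin (n + b) → Fin (m + b) :=
  Fin.addCases (fun i => Fin.castAdd b (ρ i)) (fun j => Fin.natAdd m j)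

mutual

def Term.rename {n : ℕ} : Term L σ k n → {m : ℕ} → (Fin n → Fin m) → Term L σ k m
  | .var i, _, ρ => .var (ρ i)
  | .func g ts, _, ρ => .func g (fun i => (ts i).rename ρ)
  | .fluent f ts, _, ρ => .fluent f (fun i => (ts i).rename ρ)
  | .count b φ, _, ρ => .count b (φ.rename (liftRen b ρ))

def Formula.rename {n : ℕ} : Formula L σ k n → {m : ℕ} → (Fin n → Fin m) → Formula L σ k m
  | .falsum, _, _ => .falsum
  | .eq t₁ t₂, _, ρ => .eq (t₁.rename ρ) (t₂.rename ρ)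
  | .rigid R ts, _, ρ => .rigid R (fun i => (ts i).rename ρ)
  | .fluent P ts, _, ρ => .fluent P (fun i => (ts i).rename ρ)
  | .actEq a A ts, _, ρ => .actEq a A (fun i => (ts i).rename ρ)
  | .imp φ ψ, _, ρ => .imp (φ.rename ρ) (ψ.rename ρ)
  | .all b φ, _, ρ => .all b (φ.rename (liftRen b ρ))
  | .tc c φ us vs, _, ρ =>
      .tc c (φ.rename (liftRen (c + c) ρ)) (fun i => (us i).rename ρ) (fun i => (vs i).rename ρ)

end

/-- Weakening by `b` fresh variables. -/
def Term.wk (b : ℕ) (t : Term L σ k n) : Term L σ k (n + b) := t.rename (Fin.castAdd b)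

/-- Weakening by `b` fresh variables. -/
def Formula.wk (b : ℕ) (φ : Formula L σ k n) : Formula L σ k (n + b) := φ.rename (Fin.castAdd b)

/-- Extension of a substitution under a binder of `b` variables. -/
def liftSub (b : ℕ) (θ : Fin n → Term L σ k m) : Fin (n + b) → Term L σ k (m + b) :=
  Fin.addCases (fun i => (θ i).wk b) (fun j => .var (Fin.natAdd m j))

mutual

def Term.subst {n : ℕ} : Term L σ k n → {m : ℕ} → (Fin n → Term L σ k m) → Term L σ k m
  | .var i, _, θ => θ i
  | .func g ts, _, θ => .func g (fun i => (ts i).subst θ)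
  | .fluent f ts, _, θ => .fluent f (fun i => (ts i).subst θ)
  | .count b φ, _, θ => .count b (φ.subst (liftSub b θ))

def Formula.subst {n : ℕ} :
    Formula L σ k n → {m : ℕ} → (Fin n → Term L σ k m) → Formula L σ k m
  | .falsum, _, _ => .falsum
  | .eq t₁ t₂, _, θ => .eq (t₁.subst θ) (t₂.subst θ)
  | .rigid R ts, _, θ => .rigid R (fun i => (ts i).subst θ)
  | .fluent P ts, _, θ => .fluent P (fun i => (ts i).subst θ)
  | .actEq a A ts, _, θ => .actEq a A (fun i => (ts i).subst θ)
  | .imp φ ψ, _, θ => .imp (φ.subst θ) (ψ.subst θ)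
  | .all b φ, _, θ => .all b (φ.subst (liftSub b θ))
  | .tc c φ us vs, _, θ =>
      .tc c (φ.subst (liftSub (c + c) θ)) (fun i => (us i).subst θ) (fun i => (vs i).subst θ)

end

/-! ## Structures -/

/-- An object domain: an interpretation of the rigid symbols, together with an embedding of the
values of counting terms (natural numbers, and `⊤` for an infinite count). -/
class ObjectDomain (L : FirstOrder.Language.{0, 0}) (O : Type) extends L.Structure O where
  num : ℕ∞ → O
  num_injective : Function.Injective num

/-- A first-order structure for the situation calculus with object domain `O`. No axiom is imposed
on it; as always in many-sorted logic the domains are not empty. -/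
structure SitStr (σ : Signature) (O : Type) where
  Act : Type
  Sit : Type
  act_nonempty : Nonempty Act
  S0 : Sit
  doA : Act → Sit → Sit
  lt : Sit → Sit → Prop
  Poss : Act → Sit → Prop
  actFn : (A : σ.Act) → (Fin (σ.actArity A) → O) → Act
  rel : (P : σ.Rel) → (Fin (σ.relArity P) → O) → Sit → Prop
  fn : (f : σ.Fn) → (Fin (σ.fnArity f) → O) → Sit → O

variable {O : Type} [ObjectDomain L O]

mutual

/-- Value of `t[s]` under the assignments `a` and `v` of action and object variables. -/
noncomputable def Term.eval (M : SitStr σ O) (s : M.Sit) (a : Fin k → M.Act) {n : ℕ} :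
    Term L σ k n → (Fin n → O) → O
  | .var i, v => v i
  | .func g ts, v => FirstOrder.Language.Structure.funMap g (fun i => (ts i).eval M s a v)
  | .fluent f ts, v => M.fn f (fun i => (ts i).eval M s a v) s
  | .count b φ, v =>
      ObjectDomain.num L (Set.encard {w : Fin b → O | φ.eval M s a (Fin.append v w)})

/-- Truth of `φ[s]` under the assignments `a` and `v` of action and object variables. -/
noncomputable def Formula.eval (M : SitStr σ O) (s : M.Sit) (a : Fin k → M.Act) {n : ℕ} :
    Formula L σ k n → (Fin n → O) → Prop
  | .falsum, _ => False
  | .eq t₁ t₂, v => t₁.eval M s a v = t₂.eval M s a v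
  | .rigid R ts, v => FirstOrder.Language.Structure.RelMap R (fun i => (ts i).eval M s a v)
  | .fluent P ts, v => M.rel P (fun i => (ts i).eval M s a v) s
  | .actEq j A ts, v => a j = M.actFn A (fun i => (ts i).eval M s a v)
  | .imp φ ψ, v => φ.eval M s a v → ψ.eval M s a v
  | .all b φ, v => ∀ w : Fin b → O, φ.eval M s a (Fin.append v w)
  | .tc c φ us vs, v =>
      Relation.ReflTransGen
        (fun x y : Fin c → O => φ.eval M s a (Fin.append v (Fin.append x y)))
        (fun i => (us i).eval M s a v) (fun i => (vs i).eval M s a v)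

end

/-- `M, v ⊨ φ[s]` for a formula without action variables. -/
def Formula.Holds (M : SitStr σ O) (s : M.Sit) (φ : Formula L σ 0 n) (v : Fin n → O) : Prop :=
  φ.eval M s Fin.elim0 v

/-- `M ⊨ φ[s]` for a closed formula. -/
def Formula.HoldsAt (M : SitStr σ O) (s : M.Sit) (φ : Formula L σ 0 0) : Prop :=
  φ.Holds M s Fin.elim0

/-- The first-order entailment `⊨_fo ∀ s. Γ(s) ⊃ φ[s]` (universal closure of `φ`), over all
first-order structures, not only over models of a basic action theory. -/
def FOEntails (Γ : Set (Formula L σ 0 0)) (φ : Formula L σ 0 n) : Prop :=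
  ∀ (O : Type) [ObjectDomain L O] (M : SitStr σ O) (s : M.Sit),
    (∀ γ ∈ Γ, γ.HoldsAt M s) → ∀ v : Fin n → O, φ.Holds M s v

/-- The first-order entailment `Γ ⊨_fo φ` between closed formulas about the initial situation. -/
def FOEntailsInit (Γ : Set (Formula L σ 0 0)) (φ : Formula L σ 0 0) : Prop :=
  ∀ (O : Type) [ObjectDomain L O] (M : SitStr σ O),
    (∀ γ ∈ Γ, γ.HoldsAt M M.S0) → φ.HoldsAt M M.S0

namespace SitStr

/-- `s ⊑ s'`. -/
def le (M : SitStr σ O) (s s' : M.Sit) : Prop := M.lt s s' ∨ s = s'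

/-- `Exec(s)`. -/
def Exec (M : SitStr σ O) (s : M.Sit) : Prop :=
  ∀ (a : M.Act) (s' : M.Sit), M.le (M.doA a s') s → M.Poss a s'

/-- The foundational axioms for situations. -/
structure Foundational (M : SitStr σ O) : Prop where
  do_inj : ∀ a s a' s', M.doA a s = M.doA a' s' → a = a' ∧ s = s'
  induction : ∀ Q : M.Sit → Prop, Q M.S0 → (∀ a s, Q s → Q (M.doA a s)) → ∀ s, Q s
  not_lt_S0 : ∀ s, ¬ M.lt s M.S0
  lt_do : ∀ a s s', M.lt s (M.doA a s') ↔ M.le s s'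

/-- The unique name axioms for actions. -/
def UniqueNames (M : SitStr σ O) : Prop :=
  Function.Injective (fun p : (A : σ.Act) × (Fin (σ.actArity A) → O) => M.actFn p.1 p.2)

end SitStr

/-! ## Basic action theories -/

/-- A basic action theory, given by its domain dependent parts. -/
structure BAT (L : FirstOrder.Language.{0, 0}) (σ : Signature) where
  /-- `Poss(A(x⃗), s) ≡ Π_A(x⃗, s)` -/
  pre : (A : σ.Act) → Formula L σ 0 (σ.actArity A)
  /-- `P(y⃗, do(a, s)) ≡ φ_P(y⃗, a, s)` -/
  ssaRel : (P : σ.Rel) → Formula L σ 1 (σ.relArity P)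
  /-- `f(y⃗, do(a, s)) = z ≡ ψ_f(y⃗, z, a, s)`; the last variable is `z` -/
  ssaFn : (f : σ.Fn) → Formula L σ 1 (σ.fnArity f + 1)
  /-- the initial knowledge base -/
  initial : Set (Formula L σ 0 0)

namespace BAT

/-- `M` is a model of the basic action theory `D`. -/
structure IsModel (D : BAT L σ) (M : SitStr σ O) : Prop where
  foundational : M.Foundational
  uniqueNames : M.UniqueNames
  pre : ∀ A x s, M.Poss (M.actFn A x) s ↔ (D.pre A).Holds M s x
  ssaRel : ∀ P y a s, M.rel P y (M.doA a s) ↔ (D.ssaRel P).eval M s (fun _ => a) y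
  ssaFn : ∀ f y a s z, M.fn f y (M.doA a s) = z ↔
    (D.ssaFn f).eval M s (fun _ => a) (Fin.append y (fun _ : Fin 1 => z))
  initial : ∀ φ ∈ D.initial, φ.HoldsAt M M.S0

/-- `φ` is a state constraint for `D`: `D ⊨ ∀ s. Exec(s) ⊃ φ(s)`. -/
def IsStateConstraint (D : BAT L σ) (φ : Formula L σ 0 0) : Prop :=
  ∀ (O : Type) [ObjectDomain L O] (M : SitStr σ O), D.IsModel M →
    ∀ s, M.Exec s → φ.HoldsAt M s

/-- Reiter's functional fluent consistency property: the unique name axioms and the initial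
knowledge base entail `∀ a, s, y⃗. ∃! z. ψ_f(y⃗, z, a, s)`. -/
def FnConsistent (D : BAT L σ) : Prop :=
  ∀ (O : Type) [ObjectDomain L O] (M : SitStr σ O), M.UniqueNames →
    (∀ φ ∈ D.initial, φ.HoldsAt M M.S0) →
      ∀ (f : σ.Fn) (a : M.Act) (s : M.Sit) (y : Fin (σ.fnArity f) → O),
        ∃! z, (D.ssaFn f).eval M s (fun _ => a) (Fin.append y (fun _ : Fin 1 => z))

end BAT

/-! ## Golog programs -/

/-- Golog programs with free object variables in `Fin n`. -/
inductive Prog (L : FirstOrder.Language.{0, 0}) (σ : Signature) : ℕ → Type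
  | act {n : ℕ} (A : σ.Act) (ts : Fin (σ.actArity A) → Term L σ 0 n) : Prog L σ n
  | test {n : ℕ} (φ : Formula L σ 0 n) : Prog L σ n
  | seq {n : ℕ} (δ₁ δ₂ : Prog L σ n) : Prog L σ n
  | choice {n : ℕ} (δ₁ δ₂ : Prog L σ n) : Prog L σ n
  | pick {n : ℕ} (δ : Prog L σ (n + 1)) : Prog L σ n
  | star {n : ℕ} (δ : Prog L σ n) : Prog L σ n

namespace Prog

def rename {n : ℕ} : Prog L σ n → {m : ℕ} → (Fin n → Fin m) → Prog L σ m
  | act A ts, _, ρ => act A (fun i => (ts i).rename ρ)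
  | test φ, _, ρ => test (φ.rename ρ)
  | seq δ₁ δ₂, _, ρ => seq (δ₁.rename ρ) (δ₂.rename ρ)
  | choice δ₁ δ₂, _, ρ => choice (δ₁.rename ρ) (δ₂.rename ρ)
  | pick δ, _, ρ => pick (δ.rename (liftRen 1 ρ))
  | star δ, _, ρ => star (δ.rename ρ)

/-- Weakening by `b` fresh variables. -/
def wk (b : ℕ) (δ : Prog L σ n) : Prog L σ (n + b) := δ.rename (Fin.castAdd b)

/-- The program does not involve iteration. -/
def IterFree {n : ℕ} : Prog L σ n → Prop
  | act _ _ => True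
  | test _ => True
  | seq δ₁ δ₂ => δ₁.IterFree ∧ δ₂.IterFree
  | choice δ₁ δ₂ => δ₁.IterFree ∧ δ₂.IterFree
  | pick δ => δ.IterFree
  | star _ => False

end Prog

/-- Programs of a structure: object variables have been replaced by objects, so that action terms
and tests depend on the situation only. `nil` is the empty program. -/
inductive GProg (M : SitStr σ O) : Type
  | nil : GProg M
  | act (α : M.Sit → M.Act) : GProg M
  | test (φ : M.Sit → Prop) : GProg M
  | seq (δ₁ δ₂ : GProg M) : GProg M
  | choice (δ₁ δ₂ : GProg M) : GProg M
  | pick (δ : O → GProg M) : GProg M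
  | star (δ : GProg M) : GProg M

/-- The instance of a program under an assignment of its free variables. -/
noncomputable def Prog.inst (M : SitStr σ O) {n : ℕ} : Prog L σ n → (Fin n → O) → GProg M
  | .act A ts, v => .act (fun s => M.actFn A (fun i => (ts i).eval M s Fin.elim0 v))
  | .test φ, v => .test (fun s => φ.Holds M s v)
  | .seq δ₁ δ₂, v => .seq (δ₁.inst M v) (δ₂.inst M v)
  | .choice δ₁ δ₂, v => .choice (δ₁.inst M v) (δ₂.inst M v)
  | .pick δ, v => .pick (fun x => δ.inst M (Fin.append v (fun _ : Fin 1 => x)))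
  | .star δ, v => .star (δ.inst M v)

namespace GProg

/-- `Final(δ, s)`. -/
def Final {M : SitStr σ O} : GProg M → M.Sit → Prop
  | nil, _ => True
  | act _, _ => False
  | test _, _ => False
  | seq δ₁ δ₂, s => δ₁.Final s ∧ δ₂.Final s
  | choice δ₁ δ₂, s => δ₁.Final s ∨ δ₂.Final s
  | pick δ, s => ∃ x, (δ x).Final s
  | star _, _ => True

/-- `Trans(δ, s, δ', s')`. -/
def Trans {M : SitStr σ O} : GProg M → M.Sit → GProg M → M.Sit → Prop
  | nil, _, _, _ => False
  | act α, s, δ', s' => M.Poss (α s) s ∧ δ' = nil ∧ s' = M.doA (α s) s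
  | test φ, s, δ', s' => φ s ∧ δ' = nil ∧ s' = s
  | seq δ₁ δ₂, s, δ', s' =>
      (∃ γ, δ' = seq γ δ₂ ∧ δ₁.Trans s γ s') ∨ (δ₁.Final s ∧ δ₂.Trans s δ' s')
  | choice δ₁ δ₂, s, δ', s' => δ₁.Trans s δ' s' ∨ δ₂.Trans s δ' s'
  | pick δ, s, δ', s' => ∃ x, (δ x).Trans s δ' s'
  | star δ, s, δ', s' => ∃ γ, δ' = seq γ (star δ) ∧ δ.Trans s γ s'

/-- `Trans*(δ, s, δ', s')`. -/
def TransStar {M : SitStr σ O} (δ : GProg M) (s : M.Sit) (δ' : GProg M) (s' : M.Sit) : Prop :=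
  Relation.ReflTransGen (fun p q : GProg M × M.Sit => p.1.Trans p.2 q.1 q.2) (δ, s) (δ', s')

/-- `Do(δ, s, s')`. -/
def Do {M : SitStr σ O} (δ : GProg M) (s s' : M.Sit) : Prop :=
  ∃ δ', δ.TransStar s δ' s' ∧ δ'.Final s'

end GProg

/-! ## Infinite histories, trajectory constraints, generalized planning problems -/

/-- Infinite histories, as the sequences of their finite initial segments. -/
structure InfHist (M : SitStr σ O) where
  seg : ℕ → M.Sit
  seg_zero : seg 0 = M.S0
  seg_succ : ∀ i, ∃ a, seg (i + 1) = M.doA a (seg i)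

/-- `s ⊏ h`. -/
def InfHist.Contains {M : SitStr σ O} (h : InfHist M) (s : M.Sit) : Prop := ∃ i, h.seg i = s

/-- Situation calculus formulas with a free variable `h` for infinite histories, and free object,
action and situation variables in `Fin n`, `Fin k` and `Fin l`. Situation terms are variables;
`S₀` and `do` occur in the atoms `isS0` and `isDo`, so that nested terms are expressed with the
help of quantifiers. -/
inductive TrajFml (L : FirstOrder.Language.{0, 0}) (σ : Signature) : ℕ → ℕ → ℕ → Type
  /-- `φ[sᵢ]` -/
  | state {n k l : ℕ} (φ : Formula L σ k n) (i : Fin l) : TrajFml L σ n k l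
  /-- `sᵢ = S₀` -/
  | isS0 {n k l : ℕ} (i : Fin l) : TrajFml L σ n k l
  /-- `sᵢ = do(a, sⱼ)` -/
  | isDo {n k l : ℕ} (i : Fin l) (a : Fin k) (j : Fin l) : TrajFml L σ n k l
  | poss {n k l : ℕ} (a : Fin k) (i : Fin l) : TrajFml L σ n k l
  | eqAct {n k l : ℕ} (a b : Fin k) : TrajFml L σ n k l
  | eqSit {n k l : ℕ} (i j : Fin l) : TrajFml L σ n k l
  /-- `sᵢ ⊏ sⱼ` -/
  | lt {n k l : ℕ} (i j : Fin l) : TrajFml L σ n k l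
  /-- `sᵢ ⊏ h` -/
  | ltHist {n k l : ℕ} (i : Fin l) : TrajFml L σ n k l
  | falsum {n k l : ℕ} : TrajFml L σ n k l
  | imp {n k l : ℕ} (C C' : TrajFml L σ n k l) : TrajFml L σ n k l
  | allObj {n k l : ℕ} (C : TrajFml L σ (n + 1) k l) : TrajFml L σ n k l
  | allAct {n k l : ℕ} (C : TrajFml L σ n (k + 1) l) : TrajFml L σ n k l
  | allSit {n k l : ℕ} (C : TrajFml L σ n k (l + 1)) : TrajFml L σ n k l

def TrajFml.eval (M : SitStr σ O) (h : InfHist M) {n k l : ℕ} :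
    TrajFml L σ n k l → (Fin n → O) → (Fin k → M.Act) → (Fin l → M.Sit) → Prop
  | .state φ i, v, a, s => φ.eval M (s i) a v
  | .isS0 i, _, _, s => s i = M.S0
  | .isDo i b j, _, a, s => s i = M.doA (a b) (s j)
  | .poss b i, _, a, s => M.Poss (a b) (s i)
  | .eqAct b c, _, a, _ => a b = a c
  | .eqSit i j, _, _, s => s i = s j
  | .lt i j, _, _, s => M.lt (s i) (s j)
  | .ltHist i, _, _, s => h.Contains (s i)
  | .falsum, _, _, _ => False
  | .imp C C', v, a, s => C.eval M h v a s → C'.eval M h v a s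
  | .allObj C, v, a, s => ∀ x : O, C.eval M h (Fin.append v (fun _ : Fin 1 => x)) a s
  | .allAct C, v, a, s => ∀ b : M.Act, C.eval M h v (Fin.append a (fun _ : Fin 1 => b)) s
  | .allSit C, v, a, s => ∀ t : M.Sit, C.eval M h v a (Fin.append s (fun _ : Fin 1 => t))

/-- A trajectory constraint has no free variable other than the infinite history. -/
abbrev TrajConstraint (L : FirstOrder.Language.{0, 0}) (σ : Signature) := TrajFml L σ 0 0 0

/-- `M ⊨ C(h)`. -/
def TrajFml.HoldsOn {M : SitStr σ O} (C : TrajConstraint L σ) (h : InfHist M) : Prop :=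
  C.eval M h Fin.elim0 Fin.elim0 Fin.elim0

/-- A generalized planning problem `⟨D, C, G⟩`. -/
structure GPlanning (L : FirstOrder.Language.{0, 0}) (σ : Signature) where
  bat : BAT L σ
  constraint : TrajConstraint L σ
  goal : Formula L σ 0 0

/-- The trajectory constraint holds on all infinite histories (for instance, it is `⊤`). -/
def GPlanning.TrivialConstraint (G : GPlanning L σ) : Prop :=
  ∀ (O : Type) [ObjectDomain L O] (M : SitStr σ O), G.bat.IsModel M →
    ∀ h : InfHist M, G.constraint.HoldsOn h

/-- `Term(δ, s, C)`: no infinite history through `s` that satisfies `C` is an execution of `δ`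
starting in `s`. -/
def GProg.Terminates {M : SitStr σ O} (δ : GProg M) (s : M.Sit) (C : TrajConstraint L σ) : Prop :=
  ¬ ∃ h : InfHist M, C.HoldsOn h ∧ h.Contains s ∧
    ∀ s', h.Contains s' → M.le s s' → ∃ δ', δ.TransStar s δ' s'

/-- The infinite history `h` is generated by the infinite program `p 0; p 1; p 2; …`. -/
def InfHist.GeneratedBy {M : SitStr σ O} (h : InfHist M) (p : ℕ → GProg M) : Prop :=
  ∃ t : ℕ → M.Sit, t 0 = M.S0 ∧ ∀ i, (p i).Do (t i) (t (i + 1)) ∧ h.Contains (t i)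

/-! ## Refinement mappings and sound abstractions -/

/-- Refinement mappings from `σh` (high level) to `σl` (low level). -/
structure RefMap (L : FirstOrder.Language.{0, 0}) (σh σl : Signature) where
  act : (A : σh.Act) → Prog L σl (σh.actArity A)
  rel : (P : σh.Rel) → Formula L σl 0 (σh.relArity P)
  fn : (f : σh.Fn) → Term L σl 0 (σh.fnArity f)

mutual

/-- `m(t)`: high-level symbols are replaced by their low-level definitions. -/
def Term.map (r : RefMap L σh σl) {n : ℕ} : Term L σh 0 n → Term L σl 0 n
  | .var i => .var i
  | .func g ts => .func g (fun i => (ts i).map r)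
  | .fluent f ts => (r.fn f).subst (fun i => (ts i).map r)
  | .count b φ => .count b (φ.map r)

/-- `m(φ)`: high-level symbols are replaced by their low-level definitions. -/
def Formula.map (r : RefMap L σh σl) {n : ℕ} : Formula L σh 0 n → Formula L σl 0 n
  | .falsum => .falsum
  | .eq t₁ t₂ => .eq (t₁.map r) (t₂.map r)
  | .rigid R ts => .rigid R (fun i => (ts i).map r)
  | .fluent P ts => (r.rel P).subst (fun i => (ts i).map r)
  | .actEq a _ _ => a.elim0
  | .imp φ ψ => .imp (φ.map r) (ψ.map r)
  | .all b φ => .all b (φ.map r)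
  | .tc c φ us vs => .tc c (φ.map r) (fun i => (us i).map r) (fun i => (vs i).map r)

end

/-- The high-level action `A(x⃗)` as a program. -/
def actProg (L : FirstOrder.Language.{0, 0}) (A : σ.Act) : Prog L σ (σ.actArity A) :=
  .act A (fun i => .var i)

/-- Ground high-level actions `A(x⃗)` over the object domain `O`. -/
abbrev GroundAct (σ : Signature) (O : Type) := (A : σ.Act) × (Fin (σ.actArity A) → O)

/-- `s_h ∼_m s_l`. -/
def MIso (r : RefMap L σh σl) (Mh : SitStr σh O) (Ml : SitStr σl O)
    (sh : Mh.Sit) (sl : Ml.Sit) : Prop :=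
  (∀ P y, Mh.rel P y sh ↔ (r.rel P).Holds Ml sl y) ∧
  (∀ f y z, Mh.fn f y sh = z ↔ (r.fn f).eval Ml sl Fin.elim0 y = z)

/-- `B` is an `m`-simulation relation between `Mh` and `Ml`. -/
structure IsSimulation (r : RefMap L σh σl) (Ch : TrajConstraint L σh) (Cl : TrajConstraint L σl)
    (Mh : SitStr σh O) (Ml : SitStr σl O) (B : Mh.Sit → Ml.Sit → Prop) : Prop where
  start : B Mh.S0 Ml.S0
  iso : ∀ sh sl, B sh sl → MIso r Mh Ml sh sl
  term : ∀ sh sl, B sh sl → ∀ A x, ((r.act A).inst Ml x).Terminates sl Cl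
  step : ∀ sh sl, B sh sl → ∀ A x sl', ((r.act A).inst Ml x).Do sl sl' →
    ∃ sh', ((actProg L A).inst Mh x).Do sh sh' ∧ B sh' sl'
  inf : ∀ ω : ℕ → GroundAct σh O,
    (∃ h : InfHist Ml, h.GeneratedBy (fun i => (r.act (ω i).1).inst Ml (ω i).2) ∧
      Cl.HoldsOn h) →
    ∃ h : InfHist Mh, h.GeneratedBy (fun i => (actProg L (ω i).1).inst Mh (ω i).2) ∧
      Ch.HoldsOn h

/-- `B` is an `m`-back-simulation relation between `Mh` and `Ml`. -/
structure IsBackSimulation (r : RefMap L σh σl) (Ch : TrajConstraint L σh)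
    (Cl : TrajConstraint L σl) (Mh : SitStr σh O) (Ml : SitStr σl O)
    (B : Mh.Sit → Ml.Sit → Prop) : Prop where
  start : B Mh.S0 Ml.S0
  iso : ∀ sh sl, B sh sl → MIso r Mh Ml sh sl
  term : ∀ sh sl, B sh sl → ∀ A x, ((r.act A).inst Ml x).Terminates sl Cl
  step : ∀ sh sl, B sh sl → ∀ A x sh', ((actProg L A).inst Mh x).Do sh sh' →
    ∃ sl', ((r.act A).inst Ml x).Do sl sl' ∧ B sh' sl'
  inf : ∀ ω : ℕ → GroundAct σh O,
    (∃ h : InfHist Mh, h.GeneratedBy (fun i => (actProg L (ω i).1).inst Mh (ω i).2) ∧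
      Ch.HoldsOn h) →
    ∃ h : InfHist Ml, h.GeneratedBy (fun i => (r.act (ω i).1).inst Ml (ω i).2) ∧
      Cl.HoldsOn h

/-- `Gh` is a weak sound `m`-abstraction of `Gl`. -/
def WeakSoundAbstraction (r : RefMap L σh σl) (Gh : GPlanning L σh) (Gl : GPlanning L σl) :
    Prop :=
  ∀ (O : Type) [ObjectDomain L O] (Ml : SitStr σl O), Gl.bat.IsModel Ml →
    ∃ Mh : SitStr σh O, Gh.bat.IsModel Mh ∧
      ∃ B, IsBackSimulation r Gh.constraint Gl.constraint Mh Ml B ∧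
        ∀ sh sl, B sh sl → Gh.goal.HoldsAt Mh sh → Gl.goal.HoldsAt Ml sl

/-- `Gh` is a sound `m`-abstraction of `Gl`. -/
def SoundAbstraction (r : RefMap L σh σl) (Gh : GPlanning L σh) (Gl : GPlanning L σl) : Prop :=
  WeakSoundAbstraction r Gh Gl ∧
  ∀ (O : Type) [ObjectDomain L O] (Ml : SitStr σl O), Gl.bat.IsModel Ml →
    ∃ Mh : SitStr σh O, Gh.bat.IsModel Mh ∧
      ∃ B, IsSimulation r Gh.constraint Gl.constraint Mh Ml B ∧
        ∀ sh sl, B sh sl → Gh.goal.HoldsAt Mh sh → Gl.goal.HoldsAt Ml sl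

/-! ## Regression and its extensions -/

open Classical in
mutual

/-- Replacement of the action variable by the action term `A(us)`. -/
noncomputable def Term.instAct (A : σ.Act) {n : ℕ} :
    Term L σ 1 n → (Fin (σ.actArity A) → Term L σ 0 n) → Term L σ 0 n
  | .var i, _ => .var i
  | .func g ts, us => .func g (fun i => (ts i).instAct A us)
  | .fluent f ts, us => .fluent f (fun i => (ts i).instAct A us)
  | .count b φ, us => .count b (φ.instAct A (fun i => (us i).wk b))

/-- Replacement of the action variable by the action term `A(us)`, where the resulting equations
`A(us) = A'(ts)` are simplified by the unique name axioms. -/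
noncomputable def Formula.instAct (A : σ.Act) {n : ℕ} :
    Formula L σ 1 n → (Fin (σ.actArity A) → Term L σ 0 n) → Formula L σ 0 n
  | .falsum, _ => .falsum
  | .eq t₁ t₂, us => .eq (t₁.instAct A us) (t₂.instAct A us)
  | .rigid R ts, us => .rigid R (fun i => (ts i).instAct A us)
  | .fluent P ts, us => .fluent P (fun i => (ts i).instAct A us)
  | .actEq _ A' ts, us =>
      if h : A' = A then
        .bigConj (fun i : Fin (σ.actArity A) =>
          .eq (us i) ((ts (Fin.cast (congrArg σ.actArity h.symm) i)).instAct A us))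
      else .falsum
  | .imp φ ψ, us => .imp (φ.instAct A us) (ψ.instAct A us)
  | .all b φ, us => .all b (φ.instAct A (fun i => (us i).wk b))
  | .tc c φ ts ts', us =>
      .tc c (φ.instAct A (fun i => (us i).wk (c + c)))
        (fun i => (ts i).instAct A us) (fun i => (ts' i).instAct A us)

end

namespace BAT

/-- `φ_{P,A}(x⃗, y⃗, s)`, i.e. `φ_P(y⃗, A(x⃗), s)` simplified by the unique name axioms; the
variables `x⃗` come first. -/
noncomputable def ssaRelAt (D : BAT L σ) (A : σ.Act) (P : σ.Rel) :
    Formula L σ 0 (σ.actArity A + σ.relArity P) :=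
  ((D.ssaRel P).rename (Fin.natAdd (σ.actArity A))).instAct A
    (fun i => .var (Fin.castAdd (σ.relArity P) i))

/-- `ψ_{f,A}(x⃗, y⃗, z, s)`, i.e. `ψ_f(y⃗, z, A(x⃗), s)` simplified by the unique name axioms; the
variables are ordered as `x⃗, y⃗, z`. -/
noncomputable def ssaFnAt (D : BAT L σ) (A : σ.Act) (f : σ.Fn) :
    Formula L σ 0 (σ.actArity A + (σ.fnArity f + 1)) :=
  ((D.ssaFn f).rename (Fin.natAdd (σ.actArity A))).instAct A
    (fun i => .var (Fin.castAdd (σ.fnArity f + 1) i))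

end BAT

/-- The formula `∃ z₁…z_j. ⋀ᵢ gᵢ(zᵢ) ∧ body`; the last variable of `gᵢ` is set to `zᵢ`, and its
other variables are renamed by `ι`. -/
def Formula.bindVals {j : ℕ} (ι : Fin n → Fin m) (g : Fin j → Formula L σ k (n + 1))
    (body : Formula L σ k (m + j)) : Formula L σ k m :=
  .ex j (.conj
    (.bigConj fun i => (g i).rename
      (Fin.addCases (fun l => Fin.castAdd j (ι l)) (fun _ => Fin.natAdd m i)))
    body)

mutual

/-- One-step regression of the equation `t[do(A(us), s)] = y`, where `y` is the last variable of the
result. Every functional fluent term `f(t⃗)` at `do(A(us), s)` is replaced by a new existentially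
quantified variable that is described by the successor state axiom of `f`. -/
noncomputable def Term.regress (D : BAT L σ) (A : σ.Act) {n : ℕ} :
    Term L σ 0 n → (Fin (σ.actArity A) → Term L σ 0 n) → Formula L σ 0 (n + 1)
  | .var i, _ => .eq (.var (Fin.castAdd 1 i)) (.var (Fin.natAdd n 0))
  | .func (j := j) g ts, us =>
      .bindVals (Fin.castAdd 1) (fun i => (ts i).regress D A us)
        (.eq (.func g (fun i => .var (Fin.natAdd (n + 1) i)))
          (.var (Fin.castAdd j (Fin.natAdd n 0))))
  | .fluent f ts, us =>
      .bindVals (Fin.castAdd 1) (fun i => (ts i).regress D A us)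
        ((D.ssaFnAt A f).subst (Fin.addCases
          (fun i => ((us i).wk 1).wk (σ.fnArity f))
          (Fin.addCases
            (fun i => .var (Fin.natAdd (n + 1) i))
            (fun _ : Fin 1 => .var (Fin.castAdd (σ.fnArity f) (Fin.natAdd n 0))))))
  | .count b φ, us =>
      .eq ((Term.count b (φ.regress D A (fun i => (us i).wk b))).wk 1) (.var (Fin.natAdd n 0))

/-- One-step regression of `φ[do(A(us), s)]`: a formula about `s`, where the terms `us` are
evaluated in `s`. -/
noncomputable def Formula.regress (D : BAT L σ) (A : σ.Act) {n : ℕ} :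
    Formula L σ 0 n → (Fin (σ.actArity A) → Term L σ 0 n) → Formula L σ 0 n
  | .falsum, _ => .falsum
  | .eq t₁ t₂, us =>
      .ex 1 (.conj (t₁.regress D A us) (t₂.regress D A us))
  | .rigid R ts, us =>
      .bindVals id (fun i => (ts i).regress D A us)
        (.rigid R (fun i => .var (Fin.natAdd n i)))
  | .fluent P ts, us =>
      .bindVals id (fun i => (ts i).regress D A us)
        ((D.ssaRelAt A P).subst (Fin.addCases
          (fun i => (us i).wk (σ.relArity P))
          (fun i => .var (Fin.natAdd n i))))
  | .actEq a _ _, _ => a.elim0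
  | .imp φ ψ, us => .imp (φ.regress D A us) (ψ.regress D A us)
  | .all b φ, us => .all b (φ.regress D A (fun i => (us i).wk b))
  | .tc c φ ts ts', us =>
      .bindVals id
        (Fin.addCases (fun i => (ts i).regress D A us) (fun i => (ts' i).regress D A us))
        (.tc c
          ((φ.regress D A (fun i => (us i).wk (c + c))).rename
            (liftRen (c + c) (Fin.castAdd (c + c))))
          (fun i => .var (Fin.natAdd n (Fin.castAdd c i)))
          (fun i => .var (Fin.natAdd n (Fin.natAdd c i))))

end

namespace BAT

/-- The existentially extended regression `R^E[φ(s), δ]`. It is defined for programs without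
iteration; the value for `δ*` is irrelevant. -/
noncomputable def regE (D : BAT L σ) {n : ℕ} : Prog L σ n → Formula L σ 0 n → Formula L σ 0 n
  | .act A ts, φ => .conj ((D.pre A).subst ts) (φ.regress D A ts)
  | .test ψ, φ => .conj ψ φ
  | .seq δ₁ δ₂, φ => D.regE δ₁ (D.regE δ₂ φ)
  | .choice δ₁ δ₂, φ => .disj (D.regE δ₁ φ) (D.regE δ₂ φ)
  | .pick δ, φ => .ex 1 (D.regE δ (φ.wk 1))
  | .star _, _ => .falsum

/-- The universally extended regression `R^U[φ(s), δ]`. It is defined for programs without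
iteration; the value for `δ*` is irrelevant. -/
noncomputable def regU (D : BAT L σ) {n : ℕ} : Prog L σ n → Formula L σ 0 n → Formula L σ 0 n
  | .act A ts, φ => .imp ((D.pre A).subst ts) (φ.regress D A ts)
  | .test ψ, φ => .imp ψ φ
  | .seq δ₁ δ₂, φ => D.regU δ₁ (D.regU δ₂ φ)
  | .choice δ₁ δ₂, φ => .conj (D.regU δ₁ φ) (D.regU δ₂ φ)
  | .pick δ, φ => .all 1 (D.regU δ (φ.wk 1))
  | .star _, _ => .falsum

/-- The executability condition `pre(δ, s) = R^E[⊤(s), δ]`. -/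
noncomputable def execCond (D : BAT L σ) (δ : Prog L σ n) : Formula L σ 0 n := D.regE δ .verum

end BAT

/-! ## The verification conditions -/

section Conditions

variable (r : RefMap L σh σl) (Dh : BAT L σh) (Dl : BAT L σl)

/-- `pre(m(A(x⃗)), s) ≡ m(Π_A(x⃗, s))`. -/
noncomputable def xiA (A : σh.Act) : Formula L σl 0 (σh.actArity A) :=
  .iff (Dl.execCond (r.act A)) ((Dh.pre A).map r)

/-- `pre(m(A(x⃗)), s) ⊃ ∀ y⃗. [R^E[m(P(y⃗))[s], m(A(x⃗))] ⊃ m(φ_{P,A}(x⃗, y⃗, s))] ∧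
[m(φ_{P,A}(x⃗, y⃗, s)) ⊃ R^U[m(P(y⃗))[s], m(A(x⃗))]]`. -/
noncomputable def zetaRel (A : σh.Act) (P : σh.Rel) : Formula L σl 0 (σh.actArity A) :=
  let δ := (r.act A).wk (σh.relArity P)
  let mP := (r.rel P).rename (Fin.natAdd (σh.actArity A))
  let mφ := (Dh.ssaRelAt A P).map r
  .imp (Dl.execCond (r.act A))
    (.all (σh.relArity P) (.conj (.imp (Dl.regE δ mP) mφ) (.imp mφ (Dl.regU δ mP))))

/-- `pre(m(A(x⃗)), s) ⊃ ∀ y⃗, z. [R^E[m(f(y⃗) = z)[s], m(A(x⃗))] ⊃ m(ψ_{f,A}(x⃗, y⃗, z, s))] ∧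
[m(ψ_{f,A}(x⃗, y⃗, z, s)) ⊃ R^U[m(f(y⃗) = z)[s], m(A(x⃗))]]`. -/
noncomputable def zetaFn (A : σh.Act) (f : σh.Fn) : Formula L σl 0 (σh.actArity A) :=
  let δ := (r.act A).wk (σh.fnArity f + 1)
  let mf := (Formula.eq ((r.fn f).wk 1) (.var (Fin.natAdd (σh.fnArity f) 0))).rename
    (Fin.natAdd (σh.actArity A))
  let mψ := (Dh.ssaFnAt A f).map r
  .imp (Dl.execCond (r.act A))
    (.all (σh.fnArity f + 1) (.conj (.imp (Dl.regE δ mf) mψ) (.imp mψ (Dl.regU δ mf))))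

end Conditions

end SitCalc

open SitCalc

/-!
Given a low-level model `Ml`, the fluents of its initial situation determine, through the
refinement mapping, an initial high-level state (`RefMap.abstractState`). The high-level successor
state axioms propagate this state along all lists of ground actions; functional fluent consistency
makes the result a model of the high-level theory (`BAT.treeModel_isModel`), the initial knowledge
base being inherited from `Ml` by the first condition. One and the same relation `LockStep`, which
executes high-level actions and their refinements side by side, serves as simulation and as
back-simulation.

The core is the correctness of regression. In a model of the low-level theory the extended
regressions say that some, respectively every, execution of an iteration-free program ends in a
situation satisfying `φ` (`BAT.eval_regE`, `BAT.eval_regU`). Hence the condition on preconditions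
states that a high-level action is possible exactly if its refinement has an execution
(`RefinesAt.poss_iff`). The conditions on successor states squeeze the new value of each
high-level fluent between the existential and the universal regression, so that every execution
of the refinement leads to an `m`-isomorphic situation (`RefinesAt.mIso_do`). Executability is
preserved along `LockStep`, so the state constraints are available at every step.

Termination holds because an iteration-free program performs boundedly many actions, while an
infinite history contains situations of every length (`Prog.IterFree.terminates`). For infinite
runs, trivial trajectory constraints reduce the task to finding some history through the given
situations. The refinement of an action may perform no action at all, so the low-level run induced
by a high-level one may stay in finitely many situations; the history is then continued by
arbitrary actions (`SitStr.Foundational.exists_infHist`).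
-/

namespace SitCalc

variable {L : FirstOrder.Language.{0, 0}} {σ σh σl : Signature} {k n m b : ℕ}
  {O : Type} [ObjectDomain L O]

/-! ### Semantics of the derived connectives -/

section Connectives

variable {M : SitStr σ O} {s : M.Sit} {a : Fin k → M.Act} {v : Fin n → O}

@[simp] theorem Formula.eval_verum : (Formula.verum : Formula L σ k n).eval M s a v := by
  simp [Formula.verum, Formula.neg, Formula.eval]

@[simp] theorem Formula.eval_conj {φ ψ : Formula L σ k n} :
    (φ.conj ψ).eval M s a v ↔ φ.eval M s a v ∧ ψ.eval M s a v := by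
  simp [Formula.conj, Formula.neg, Formula.eval]

@[simp] theorem Formula.eval_disj {φ ψ : Formula L σ k n} :
    (φ.disj ψ).eval M s a v ↔ φ.eval M s a v ∨ ψ.eval M s a v := by
  simp only [Formula.disj, Formula.neg, Formula.eval]; tauto

@[simp] theorem Formula.eval_iff {φ ψ : Formula L σ k n} :
    (φ.iff ψ).eval M s a v ↔ (φ.eval M s a v ↔ ψ.eval M s a v) := by
  simp only [Formula.iff, Formula.eval_conj, Formula.eval]; tauto

@[simp] theorem Formula.eval_ex {φ : Formula L σ k (n + b)} :
    (Formula.ex b φ).eval M s a v ↔ ∃ w : Fin b → O, φ.eval M s a (Fin.append v w) := by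
  simp [Formula.ex, Formula.neg, Formula.eval]

@[simp] theorem Formula.eval_bigConj {j : ℕ} {φs : Fin j → Formula L σ k n} :
    (Formula.bigConj φs).eval M s a v ↔ ∀ i, (φs i).eval M s a v := by
  have key : ∀ l : List (Formula L σ k n),
      (l.foldr Formula.conj Formula.verum).eval M s a v ↔ ∀ φ ∈ l, φ.eval M s a v := by
    intro l
    induction l with
    | nil => simp
    | cons φ l ih => simp [ih]
  simp [Formula.bigConj, key]

end Connectives

/-! ### Renaming and substitution -/

theorem append_comp_liftRen (ρ : Fin n → Fin m) (v : Fin m → O) (w : Fin b → O) :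
    (fun i => Fin.append v w (liftRen b ρ i)) = Fin.append (fun i => v (ρ i)) w := by
  funext i
  refine Fin.addCases (fun i => ?_) (fun i => ?_) i <;> simp [liftRen]

mutual

theorem Term.eval_rename (M : SitStr σ O) (s : M.Sit) (a : Fin k → M.Act) {n : ℕ} :
    ∀ (t : Term L σ k n) {m : ℕ} (ρ : Fin n → Fin m) (v : Fin m → O),
      (t.rename ρ).eval M s a v = t.eval M s a (fun i => v (ρ i))
  | .var i, _, ρ, v => by simp only [Term.rename, Term.eval]
  | .func g ts, _, ρ, v => by
      simp only [Term.rename, Term.eval, fun i => (ts i).eval_rename M s a ρ v]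
  | .fluent f ts, _, ρ, v => by
      simp only [Term.rename, Term.eval, fun i => (ts i).eval_rename M s a ρ v]
  | .count b φ, _, ρ, v => by
      simp only [Term.rename, Term.eval, φ.eval_rename M s a, append_comp_liftRen]

theorem Formula.eval_rename (M : SitStr σ O) (s : M.Sit) (a : Fin k → M.Act) {n : ℕ} :
    ∀ (φ : Formula L σ k n) {m : ℕ} (ρ : Fin n → Fin m) (v : Fin m → O),
      (φ.rename ρ).eval M s a v ↔ φ.eval M s a (fun i => v (ρ i))
  | .falsum, _, ρ, v => by simp only [Formula.rename, Formula.eval]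
  | .eq t₁ t₂, _, ρ, v => by
      simp only [Formula.rename, Formula.eval, t₁.eval_rename M s a, t₂.eval_rename M s a]
  | .rigid R ts, _, ρ, v => by
      simp only [Formula.rename, Formula.eval, fun i => (ts i).eval_rename M s a ρ v]
  | .fluent P ts, _, ρ, v => by
      simp only [Formula.rename, Formula.eval, fun i => (ts i).eval_rename M s a ρ v]
  | .actEq j A ts, _, ρ, v => by
      simp only [Formula.rename, Formula.eval, fun i => (ts i).eval_rename M s a ρ v]
  | .imp φ ψ, _, ρ, v => by
      simp only [Formula.rename, Formula.eval, φ.eval_rename M s a, ψ.eval_rename M s a]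
  | .all b φ, _, ρ, v => by
      simp only [Formula.rename, Formula.eval, φ.eval_rename M s a, append_comp_liftRen]
  | .tc c φ us vs, _, ρ, v => by
      simp only [Formula.rename, Formula.eval, φ.eval_rename M s a, append_comp_liftRen,
        fun i => (us i).eval_rename M s a ρ v, fun i => (vs i).eval_rename M s a ρ v]

end

@[simp] theorem Term.eval_wk (M : SitStr σ O) (s : M.Sit) (a : Fin k → M.Act)
    (t : Term L σ k n) (v : Fin n → O) (w : Fin b → O) :
    (t.wk b).eval M s a (Fin.append v w) = t.eval M s a v := by
  simp [Term.wk, Term.eval_rename]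

@[simp] theorem Formula.eval_wk (M : SitStr σ O) (s : M.Sit) (a : Fin k → M.Act)
    (φ : Formula L σ k n) (v : Fin n → O) (w : Fin b → O) :
    (φ.wk b).eval M s a (Fin.append v w) ↔ φ.eval M s a v := by
  simp [Formula.wk, Formula.eval_rename]

theorem eval_liftSub (M : SitStr σ O) (s : M.Sit) (a : Fin k → M.Act)
    (θ : Fin n → Term L σ k m) (v : Fin m → O) (w : Fin b → O) :
    (fun i => (liftSub b θ i).eval M s a (Fin.append v w)) =
      Fin.append (fun i => (θ i).eval M s a v) w := by
  funext i
  refine Fin.addCases (fun i => ?_) (fun i => ?_) i <;> simp [liftSub, Term.eval]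

mutual

theorem Term.eval_subst (M : SitStr σ O) (s : M.Sit) (a : Fin k → M.Act) {n : ℕ} :
    ∀ (t : Term L σ k n) {m : ℕ} (θ : Fin n → Term L σ k m) (v : Fin m → O),
      (t.subst θ).eval M s a v = t.eval M s a (fun i => (θ i).eval M s a v)
  | .var i, _, θ, v => by simp only [Term.subst, Term.eval]
  | .func g ts, _, θ, v => by
      simp only [Term.subst, Term.eval, fun i => (ts i).eval_subst M s a θ v]
  | .fluent f ts, _, θ, v => by
      simp only [Term.subst, Term.eval, fun i => (ts i).eval_subst M s a θ v]
  | .count b φ, _, θ, v => by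
      simp only [Term.subst, Term.eval, φ.eval_subst M s a, eval_liftSub]

theorem Formula.eval_subst (M : SitStr σ O) (s : M.Sit) (a : Fin k → M.Act) {n : ℕ} :
    ∀ (φ : Formula L σ k n) {m : ℕ} (θ : Fin n → Term L σ k m) (v : Fin m → O),
      (φ.subst θ).eval M s a v ↔ φ.eval M s a (fun i => (θ i).eval M s a v)
  | .falsum, _, θ, v => by simp only [Formula.subst, Formula.eval]
  | .eq t₁ t₂, _, θ, v => by
      simp only [Formula.subst, Formula.eval, t₁.eval_subst M s a, t₂.eval_subst M s a]
  | .rigid R ts, _, θ, v => by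
      simp only [Formula.subst, Formula.eval, fun i => (ts i).eval_subst M s a θ v]
  | .fluent P ts, _, θ, v => by
      simp only [Formula.subst, Formula.eval, fun i => (ts i).eval_subst M s a θ v]
  | .actEq j A ts, _, θ, v => by
      simp only [Formula.subst, Formula.eval, fun i => (ts i).eval_subst M s a θ v]
  | .imp φ ψ, _, θ, v => by
      simp only [Formula.subst, Formula.eval, φ.eval_subst M s a, ψ.eval_subst M s a]
  | .all b φ, _, θ, v => by
      simp only [Formula.subst, Formula.eval, φ.eval_subst M s a, eval_liftSub]
  | .tc c φ us vs, _, θ, v => by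
      simp only [Formula.subst, Formula.eval, φ.eval_subst M s a, eval_liftSub,
        fun i => (us i).eval_subst M s a θ v, fun i => (vs i).eval_subst M s a θ v]

end

theorem Prog.inst_rename (M : SitStr σ O) {n : ℕ} (δ : Prog L σ n) :
    ∀ {m : ℕ} (ρ : Fin n → Fin m) (v : Fin m → O),
      (δ.rename ρ).inst M v = δ.inst M (fun i => v (ρ i)) := by
  induction δ with
  | act A ts => intro m ρ v; simp only [Prog.rename, Prog.inst, Term.eval_rename]
  | test φ => intro m ρ v; simp only [Prog.rename, Prog.inst, Formula.Holds, Formula.eval_rename]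
  | seq δ₁ δ₂ ih₁ ih₂ => intro m ρ v; simp only [Prog.rename, Prog.inst, ih₁, ih₂]
  | choice δ₁ δ₂ ih₁ ih₂ => intro m ρ v; simp only [Prog.rename, Prog.inst, ih₁, ih₂]
  | pick δ ih => intro m ρ v; simp only [Prog.rename, Prog.inst, ih, append_comp_liftRen]
  | star δ ih => intro m ρ v; simp only [Prog.rename, Prog.inst, ih]

theorem Prog.inst_wk (M : SitStr σ O) (δ : Prog L σ n) (v : Fin n → O) (w : Fin b → O) :
    (δ.wk b).inst M (Fin.append v w) = δ.inst M v := by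
  simp [Prog.wk, Prog.inst_rename]

theorem Prog.IterFree.rename {n : ℕ} {δ : Prog L σ n} (h : δ.IterFree) :
    ∀ {m : ℕ} (ρ : Fin n → Fin m), (δ.rename ρ).IterFree := by
  induction δ with
  | act | test => intros; trivial
  | seq δ₁ δ₂ ih₁ ih₂ => exact fun ρ => ⟨ih₁ h.1 ρ, ih₂ h.2 ρ⟩
  | choice δ₁ δ₂ ih₁ ih₂ => exact fun ρ => ⟨ih₁ h.1 ρ, ih₂ h.2 ρ⟩
  | pick δ ih => exact fun ρ => ih h (liftRen 1 ρ)
  | star => exact h.elim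

/-! ### Transfer along a refinement mapping and between structures -/

mutual

theorem MIso.eval_term_map {r : RefMap L σh σl} {Mh : SitStr σh O} {Ml : SitStr σl O}
    {sh : Mh.Sit} {sl : Ml.Sit} (H : MIso r Mh Ml sh sl) {n : ℕ} :
    ∀ (t : Term L σh 0 n) (v : Fin n → O),
      (t.map r).eval Ml sl Fin.elim0 v = t.eval Mh sh Fin.elim0 v
  | .var i, v => by simp only [Term.map, Term.eval]
  | .func g ts, v => by
      simp only [Term.map, Term.eval, fun i => H.eval_term_map (ts i) v]
  | .fluent f ts, v => by
      simp only [Term.map, Term.eval, Term.eval_subst, fun i => H.eval_term_map (ts i) v]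
      exact ((H.2 f _ _).1 rfl)
  | .count b φ, v => by
      simp only [Term.map, Term.eval, fun w => H.eval_formula_map φ w]

/-- `m`-isomorphic situations satisfy the same formulas, up to the refinement mapping. -/
theorem MIso.eval_formula_map {r : RefMap L σh σl} {Mh : SitStr σh O} {Ml : SitStr σl O}
    {sh : Mh.Sit} {sl : Ml.Sit} (H : MIso r Mh Ml sh sl) {n : ℕ} :
    ∀ (φ : Formula L σh 0 n) (v : Fin n → O),
      (φ.map r).eval Ml sl Fin.elim0 v ↔ φ.eval Mh sh Fin.elim0 v
  | .falsum, v => by simp only [Formula.map, Formula.eval]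
  | .eq t₁ t₂, v => by
      simp only [Formula.map, Formula.eval, H.eval_term_map t₁, H.eval_term_map t₂]
  | .rigid R ts, v => by
      simp only [Formula.map, Formula.eval, fun i => H.eval_term_map (ts i) v]
  | .fluent P ts, v => by
      simp only [Formula.map, Formula.eval, Formula.eval_subst,
        fun i => H.eval_term_map (ts i) v]
      exact (H.1 P _).symm
  | .actEq a _ _, v => a.elim0
  | .imp φ ψ, v => by
      simp only [Formula.map, Formula.eval, H.eval_formula_map φ, H.eval_formula_map ψ]
  | .all b φ, v => by
      simp only [Formula.map, Formula.eval, fun w => H.eval_formula_map φ w]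
  | .tc c φ us vs, v => by
      simp only [Formula.map, Formula.eval, fun w => H.eval_formula_map φ w,
        fun i => H.eval_term_map (us i) v, fun i => H.eval_term_map (vs i) v]

end

/-- Two situations, possibly of different structures, in which all fluents have the same values;
`g` embeds the actions of the first structure into those of the second one. -/
structure SameState (M M' : SitStr σ O) (g : M.Act → M'.Act) (s : M.Sit) (s' : M'.Sit) :
    Prop where
  inj : Function.Injective g
  actFn : ∀ A x, g (M.actFn A x) = M'.actFn A x
  rel : ∀ P y, M.rel P y s ↔ M'.rel P y s'
  fn : ∀ f y, M.fn f y s = M'.fn f y s'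

mutual

theorem SameState.eval_term {M M' : SitStr σ O} {g : M.Act → M'.Act} {s : M.Sit} {s' : M'.Sit}
    (H : SameState M M' g s s') (a : Fin k → M.Act) {n : ℕ} :
    ∀ (t : Term L σ k n) (v : Fin n → O),
      t.eval M s a v = t.eval M' s' (fun i => g (a i)) v
  | .var i, v => by simp only [Term.eval]
  | .func g ts, v => by simp only [Term.eval, fun i => H.eval_term a (ts i) v]
  | .fluent f ts, v => by simp only [Term.eval, fun i => H.eval_term a (ts i) v, H.fn]
  | .count b φ, v => by simp only [Term.eval, fun w => H.eval_formula a φ w]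

/-- The truth value of `φ[s]` depends on the fluents in `s` only. -/
theorem SameState.eval_formula {M M' : SitStr σ O} {g : M.Act → M'.Act} {s : M.Sit}
    {s' : M'.Sit} (H : SameState M M' g s s') (a : Fin k → M.Act) {n : ℕ} :
    ∀ (φ : Formula L σ k n) (v : Fin n → O),
      φ.eval M s a v ↔ φ.eval M' s' (fun i => g (a i)) v
  | .falsum, v => by simp only [Formula.eval]
  | .eq t₁ t₂, v => by simp only [Formula.eval, H.eval_term a t₁, H.eval_term a t₂]
  | .rigid R ts, v => by simp only [Formula.eval, fun i => H.eval_term a (ts i) v]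
  | .fluent P ts, v => by simp only [Formula.eval, fun i => H.eval_term a (ts i) v, H.rel]
  | .actEq j A ts, v => by
      simp only [Formula.eval, fun i => H.eval_term a (ts i) v]
      rw [← H.actFn, H.inj.eq_iff]
  | .imp φ ψ, v => by simp only [Formula.eval, H.eval_formula a φ, H.eval_formula a ψ]
  | .all b φ, v => by simp only [Formula.eval, fun w => H.eval_formula a φ w]
  | .tc c φ us vs, v => by
      simp only [Formula.eval, fun w => H.eval_formula a φ w,
        fun i => H.eval_term a (us i) v, fun i => H.eval_term a (vs i) v]

end

/-! ### One-step regression -/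

mutual

theorem Term.eval_instAct {M : SitStr σ O} (hM : M.UniqueNames) (s : M.Sit) (A : σ.Act) {n : ℕ} :
    ∀ (t : Term L σ 1 n) (us : Fin (σ.actArity A) → Term L σ 0 n) (v : Fin n → O),
      (t.instAct A us).eval M s Fin.elim0 v =
        t.eval M s (fun _ => M.actFn A (fun i => (us i).eval M s Fin.elim0 v)) v
  | .var i, us, v => by simp only [Term.instAct, Term.eval]
  | .func g ts, us, v => by
      simp only [Term.instAct, Term.eval, fun i => (ts i).eval_instAct hM s A us v]
  | .fluent f ts, us, v => by
      simp only [Term.instAct, Term.eval, fun i => (ts i).eval_instAct hM s A us v]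
  | .count b φ, us, v => by
      simp only [Term.instAct, Term.eval, fun us v => φ.eval_instAct hM s A us v, Term.eval_wk]

/-- Instantiating the action variable by `A(us)`, with the unique name simplification, is
correct in every structure that satisfies the unique name axioms. -/
theorem Formula.eval_instAct {M : SitStr σ O} (hM : M.UniqueNames) (s : M.Sit) (A : σ.Act)
    {n : ℕ} :
    ∀ (φ : Formula L σ 1 n) (us : Fin (σ.actArity A) → Term L σ 0 n) (v : Fin n → O),
      (φ.instAct A us).eval M s Fin.elim0 v ↔
        φ.eval M s (fun _ => M.actFn A (fun i => (us i).eval M s Fin.elim0 v)) v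
  | .falsum, us, v => by simp only [Formula.instAct, Formula.eval]
  | .eq t₁ t₂, us, v => by
      simp only [Formula.instAct, Formula.eval, t₁.eval_instAct hM s A, t₂.eval_instAct hM s A]
  | .rigid R ts, us, v => by
      simp only [Formula.instAct, Formula.eval, fun i => (ts i).eval_instAct hM s A us v]
  | .fluent P ts, us, v => by
      simp only [Formula.instAct, Formula.eval, fun i => (ts i).eval_instAct hM s A us v]
  | .actEq j A' ts, us, v => by
      have ih := fun i => (ts i).eval_instAct hM s A us v
      by_cases h : A' = A
      · subst h
        simp only [Formula.instAct, dite_true, Formula.eval_bigConj, Formula.eval, Fin.cast_refl,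
          id, ih]
        constructor
        · intro h
          congr 1
          exact funext h
        · intro h
          have := hM (a₁ := ⟨A', _⟩) (a₂ := ⟨A', _⟩) h
          simp only [Sigma.mk.injEq, heq_eq_eq, true_and] at this
          exact congrFun this
      · simp only [Formula.instAct, dif_neg h, Formula.eval, false_iff]
        intro h'
        exact h (congrArg Sigma.fst (hM (a₁ := ⟨A, _⟩) (a₂ := ⟨A', _⟩) h')).symm
  | .imp φ ψ, us, v => by
      simp only [Formula.instAct, Formula.eval, φ.eval_instAct hM s A, ψ.eval_instAct hM s A]
  | .all b φ, us, v => by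
      simp only [Formula.instAct, Formula.eval, fun us v => φ.eval_instAct hM s A us v,
        Term.eval_wk]
  | .tc c φ ts ts', us, v => by
      simp only [Formula.instAct, Formula.eval, fun us v => φ.eval_instAct hM s A us v,
        fun i => (ts i).eval_instAct hM s A us v, fun i => (ts' i).eval_instAct hM s A us v,
        Term.eval_wk]

end

theorem BAT.eval_ssaRelAt (D : BAT L σ) {M : SitStr σ O} (hM : M.UniqueNames) (s : M.Sit)
    (A : σ.Act) (P : σ.Rel) (x : Fin (σ.actArity A) → O) (y : Fin (σ.relArity P) → O) :
    (D.ssaRelAt A P).eval M s Fin.elim0 (Fin.append x y) ↔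
      (D.ssaRel P).eval M s (fun _ => M.actFn A x) y := by
  simp [BAT.ssaRelAt, Formula.eval_instAct hM, Formula.eval_rename, Term.eval]

theorem BAT.eval_ssaFnAt (D : BAT L σ) {M : SitStr σ O} (hM : M.UniqueNames) (s : M.Sit)
    (A : σ.Act) (f : σ.Fn) (x : Fin (σ.actArity A) → O) (y : Fin (σ.fnArity f + 1) → O) :
    (D.ssaFnAt A f).eval M s Fin.elim0 (Fin.append x y) ↔
      (D.ssaFn f).eval M s (fun _ => M.actFn A x) y := by
  simp [BAT.ssaFnAt, Formula.eval_instAct hM, Formula.eval_rename, Term.eval]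

theorem Formula.eval_bindVals (M : SitStr σ O) (s : M.Sit) (a : Fin k → M.Act) {j : ℕ}
    (ι : Fin n → Fin m) (g : Fin j → Formula L σ k (n + 1)) (body : Formula L σ k (m + j))
    (v : Fin m → O) :
    (Formula.bindVals ι g body).eval M s a v ↔
      ∃ z : Fin j → O,
        (∀ i, (g i).eval M s a (Fin.append (fun l => v (ι l)) (fun _ : Fin 1 => z i))) ∧
          body.eval M s a (Fin.append v z) := by
  have key : ∀ (z : Fin j → O) (i : Fin j),
      (fun l => Fin.append v z
        (Fin.addCases (fun l => Fin.castAdd j (ι l)) (fun _ : Fin 1 => Fin.natAdd m i) l)) =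
      Fin.append (fun l => v (ι l)) (fun _ : Fin 1 => z i) := by
    intro z i
    funext l
    refine Fin.addCases (fun l => ?_) (fun l => ?_) l <;> simp
  simp only [Formula.bindVals, Formula.eval_ex, Formula.eval_conj, Formula.eval_bigConj,
    Formula.eval_rename, key]

/-- If the `i`-th bound value is described as the value `e i`, then `bindVals` evaluates its body
at `e`. -/
theorem Formula.eval_bindVals_of_eq {M : SitStr σ O} {s : M.Sit} {a : Fin k → M.Act} {j : ℕ}
    {ι : Fin n → Fin m} {g : Fin j → Formula L σ k (n + 1)} {body : Formula L σ k (m + j)}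
    {v : Fin m → O} (e : Fin j → O)
    (hg : ∀ i z, (g i).eval M s a (Fin.append (fun l => v (ι l)) (fun _ : Fin 1 => z)) ↔
      e i = z) :
    (Formula.bindVals ι g body).eval M s a v ↔ body.eval M s a (Fin.append v e) := by
  simp only [Formula.eval_bindVals, hg, ← funext_iff, exists_eq_left']

mutual

/-- The regression of `t[do(A(us), s)] = y` describes the value of `t` after the action. The premise
that `M` is a model gives the equation of each fluent term by its successor state axiom. -/
theorem Term.eval_regress {D : BAT L σ} {M : SitStr σ O} (hM : D.IsModel M) (s : M.Sit)
    (A : σ.Act) {n : ℕ} :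
    ∀ (t : Term L σ 0 n) (us : Fin (σ.actArity A) → Term L σ 0 n) (v : Fin n → O) (y : O),
      (t.regress D A us).eval M s Fin.elim0 (Fin.append v (fun _ : Fin 1 => y)) ↔
        t.eval M (M.doA (M.actFn A (fun i => (us i).eval M s Fin.elim0 v)) s) Fin.elim0 v = y
  | .var i, us, v, y => by simp [Term.regress, Formula.eval, Term.eval]
  | .func g ts, us, v, y => by
      rw [Term.regress, Formula.eval_bindVals_of_eq _ (fun i z => by
        simpa only [Fin.append_left] using (ts i).eval_regress hM s A us v z)]
      simp [Formula.eval, Term.eval]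
  | .fluent f ts, us, v, y => by
      rw [Term.regress, Formula.eval_bindVals_of_eq _ (fun i z => by
        simpa only [Fin.append_left] using (ts i).eval_regress hM s A us v z)]
      rw [Formula.eval_subst, Term.eval, hM.ssaFn, ← BAT.eval_ssaFnAt D hM.uniqueNames]
      refine iff_of_eq (congrArg _ ?_)
      funext i
      refine Fin.addCases (fun i => ?_) (fun i => ?_) i
      · simp
      · refine Fin.addCases (fun i => ?_) (fun i => ?_) i <;> simp [Term.eval]
  | .count b φ, us, v, y => by
      simp [Term.regress, Formula.eval, Term.eval, fun us v => φ.eval_regress hM s A us v]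

/-- One-step regression is correct in the models of the basic action theory. -/
theorem Formula.eval_regress {D : BAT L σ} {M : SitStr σ O} (hM : D.IsModel M) (s : M.Sit)
    (A : σ.Act) {n : ℕ} :
    ∀ (φ : Formula L σ 0 n) (us : Fin (σ.actArity A) → Term L σ 0 n) (v : Fin n → O),
      (φ.regress D A us).eval M s Fin.elim0 v ↔
        φ.eval M (M.doA (M.actFn A (fun i => (us i).eval M s Fin.elim0 v)) s) Fin.elim0 v
  | .falsum, us, v => by simp only [Formula.regress, Formula.eval]
  | .eq t₁ t₂, us, v => by
      have h₁ := t₁.eval_regress hM s A us v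
      have h₂ := t₂.eval_regress hM s A us v
      simp only [Formula.regress, Formula.eval, Formula.eval_ex, Formula.eval_conj]
      constructor
      · rintro ⟨w, hw₁, hw₂⟩
        have hw : w = fun _ => w 0 := by funext i; rw [Subsingleton.elim i 0]
        rw [hw] at hw₁ hw₂
        rw [(h₁ _).1 hw₁, (h₂ _).1 hw₂]
      · intro h
        exact ⟨_, (h₁ _).2 rfl, (h₂ _).2 h.symm⟩
  | .rigid R ts, us, v => by
      rw [Formula.regress, Formula.eval_bindVals_of_eq (ι := id) _
        (fun i z => (ts i).eval_regress hM s A us v z)]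
      simp [Formula.eval, Term.eval]
  | .fluent P ts, us, v => by
      rw [Formula.regress, Formula.eval_bindVals_of_eq (ι := id) _
        (fun i z => (ts i).eval_regress hM s A us v z)]
      rw [Formula.eval_subst, Formula.eval, hM.ssaRel, ← BAT.eval_ssaRelAt D hM.uniqueNames]
      refine iff_of_eq (congrArg _ ?_)
      funext i
      refine Fin.addCases (fun i => ?_) (fun i => ?_) i <;> simp [Term.eval]
  | .actEq a _ _, us, v => a.elim0
  | .imp φ ψ, us, v => by
      simp only [Formula.regress, Formula.eval, φ.eval_regress hM s A, ψ.eval_regress hM s A]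
  | .all b φ, us, v => by
      simp only [Formula.regress, Formula.eval, fun us v => φ.eval_regress hM s A us v,
        Term.eval_wk]
  | .tc c φ ts ts', us, v => by
      rw [Formula.regress, Formula.eval_bindVals_of_eq
        (Fin.append
          (fun i => (ts i).eval M
            (M.doA (M.actFn A (fun i => (us i).eval M s Fin.elim0 v)) s) Fin.elim0 v)
          (fun i => (ts' i).eval M
            (M.doA (M.actFn A (fun i => (us i).eval M s Fin.elim0 v)) s) Fin.elim0 v))
        (fun i => by
          refine Fin.addCases (fun i => ?_) (fun i => ?_) i
          · simpa using (ts i).eval_regress hM s A us v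
          · simpa [-Fin.natAdd_eq_addNat] using (ts' i).eval_regress hM s A us v)]
      simp [-Fin.natAdd_eq_addNat, Formula.eval, Term.eval, Formula.eval_rename,
        append_comp_liftRen, fun us v => φ.eval_regress hM s A us v]

end

/-! ### Complete executions of Golog programs -/

namespace GProg

variable {M : SitStr σ O}

/-- A complete execution is empty or begins with a transition. -/
theorem do_iff {δ : GProg M} {s s' : M.Sit} :
    δ.Do s s' ↔ (δ.Final s ∧ s' = s) ∨ ∃ γ t, δ.Trans s γ t ∧ γ.Do t s' := by
  constructor
  · rintro ⟨δ', hT, hF⟩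
    rcases Relation.ReflTransGen.cases_head hT with h | ⟨⟨γ, t⟩, h₁, h₂⟩
    · cases h
      exact .inl ⟨hF, rfl⟩
    · exact .inr ⟨γ, t, h₁, δ', h₂, hF⟩
  · rintro (⟨hF, rfl⟩ | ⟨γ, t, h₁, δ', h₂, hF⟩)
    · exact ⟨δ, .refl, hF⟩
    · exact ⟨δ', .head h₁ h₂, hF⟩

theorem do_nil {s s' : M.Sit} : (nil : GProg M).Do s s' ↔ s' = s := by
  rw [do_iff]; simp [Final, Trans]

theorem do_act {α : M.Sit → M.Act} {s s' : M.Sit} :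
    (act α : GProg M).Do s s' ↔ M.Poss (α s) s ∧ s' = M.doA (α s) s := by
  rw [do_iff]
  simp only [Final, Trans, false_and, false_or]
  constructor
  · rintro ⟨_, _, ⟨h, rfl, rfl⟩, h'⟩
    exact ⟨h, do_nil.1 h'⟩
  · rintro ⟨h, rfl⟩
    exact ⟨_, _, ⟨h, rfl, rfl⟩, do_nil.2 rfl⟩

theorem do_test {φ : M.Sit → Prop} {s s' : M.Sit} :
    (test φ : GProg M).Do s s' ↔ φ s ∧ s' = s := by
  rw [do_iff]
  simp only [Final, Trans, false_and, false_or]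
  constructor
  · rintro ⟨_, _, ⟨h, rfl, rfl⟩, h'⟩
    exact ⟨h, do_nil.1 h'⟩
  · rintro ⟨h, rfl⟩
    exact ⟨_, _, ⟨h, rfl, rfl⟩, do_nil.2 rfl⟩

theorem do_choice {δ₁ δ₂ : GProg M} {s s' : M.Sit} :
    (choice δ₁ δ₂).Do s s' ↔ δ₁.Do s s' ∨ δ₂.Do s s' := by
  rw [do_iff, do_iff (δ := δ₁), do_iff (δ := δ₂)]
  simp only [Final, Trans, or_and_right, exists_or]
  exact or_or_or_comm

theorem do_pick {δ : O → GProg M} {s s' : M.Sit} :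
    (pick δ).Do s s' ↔ ∃ x, (δ x).Do s s' := by
  rw [do_iff]
  simp only [Final, Trans]
  constructor
  · rintro (⟨⟨x, h⟩, rfl⟩ | ⟨γ, t, ⟨x, h⟩, h'⟩)
    · exact ⟨x, do_iff.2 (.inl ⟨h, rfl⟩)⟩
    · exact ⟨x, do_iff.2 (.inr ⟨γ, t, h, h'⟩)⟩
  · rintro ⟨x, h⟩
    rcases do_iff.1 h with ⟨h, rfl⟩ | ⟨γ, t, h, h'⟩
    · exact .inl ⟨⟨x, h⟩, rfl⟩
    · exact .inr ⟨γ, t, ⟨x, h⟩, h'⟩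

/-- `δ₁; δ₂` moves to `δ₂` by a transition of `δ₂` itself, in a situation where `δ₁` is final; hence
both directions are proved by induction on the transitions from the front. -/
theorem do_seq {δ₁ δ₂ : GProg M} {s s' : M.Sit} :
    (seq δ₁ δ₂).Do s s' ↔ ∃ t, δ₁.Do s t ∧ δ₂.Do t s' := by
  constructor
  · rintro ⟨δ', hT, hF⟩
    have key : ∀ p : GProg M × M.Sit,
        Relation.ReflTransGen (fun p q : GProg M × M.Sit => p.1.Trans p.2 q.1 q.2) p (δ', s') →
        ∀ δ₁, p.1 = seq δ₁ δ₂ → ∃ t, δ₁.Do p.2 t ∧ δ₂.Do t s' := by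
      intro p hp
      induction hp using Relation.ReflTransGen.head_induction_on with
      | refl =>
        rintro δ₁ rfl
        exact ⟨s', do_iff.2 (.inl ⟨hF.1, rfl⟩), do_iff.2 (.inl ⟨hF.2, rfl⟩)⟩
      | @head p q hpq hq ih =>
        obtain ⟨p, s⟩ := p
        rintro δ₁ rfl
        rcases hpq with ⟨γ, hγ, hstep⟩ | ⟨hfin, hstep⟩
        · obtain ⟨t, h₁, h₂⟩ := ih γ hγ
          exact ⟨t, do_iff.2 (.inr ⟨_, _, hstep, h₁⟩), h₂⟩
        · exact ⟨s, do_iff.2 (.inl ⟨hfin, rfl⟩),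
            do_iff.2 (.inr ⟨_, _, hstep, δ', hq, hF⟩)⟩
    exact key (seq δ₁ δ₂, s) hT δ₁ rfl
  · rintro ⟨t, ⟨δ', hT, hF⟩, h₂⟩
    have key : ∀ p : GProg M × M.Sit,
        Relation.ReflTransGen (fun p q : GProg M × M.Sit => p.1.Trans p.2 q.1 q.2) p (δ', t) →
        (seq p.1 δ₂).Do p.2 s' := by
      intro p hp
      induction hp using Relation.ReflTransGen.head_induction_on with
      | refl =>
        rcases do_iff.1 h₂ with ⟨h, rfl⟩ | ⟨γ, u, h, h'⟩
        · exact do_iff.2 (.inl ⟨⟨hF, h⟩, rfl⟩)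
        · exact do_iff.2 (.inr ⟨γ, u, .inr ⟨hF, h⟩, h'⟩)
      | @head p q hpq hq ih =>
        exact do_iff.2 (.inr ⟨_, _, .inl ⟨_, rfl, hpq⟩, ih⟩)
    exact key (δ₁, s) hT

/-- A transition stays in its situation or performs one executable action. -/
theorem Trans.sit {δ γ : GProg M} {s t : M.Sit} (h : δ.Trans s γ t) :
    t = s ∨ ∃ a, M.Poss a s ∧ t = M.doA a s := by
  induction δ generalizing γ with
  | nil => exact h.elim
  | act α => exact .inr ⟨_, h.1, h.2.2⟩
  | test φ => exact .inl h.2.2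
  | seq δ₁ δ₂ ih₁ ih₂ =>
    rcases h with ⟨_, _, h⟩ | ⟨_, h⟩
    · exact ih₁ h
    · exact ih₂ h
  | choice δ₁ δ₂ ih₁ ih₂ => exact h.elim ih₁ ih₂
  | pick δ ih => exact h.elim fun x h => ih x h
  | star δ ih => exact h.elim fun _ h => ih h.2

/-- A property of situations that is kept by executable actions is kept by programs. -/
theorem Do.preserves {Q : M.Sit → Prop} (hQ : ∀ a s, M.Poss a s → Q s → Q (M.doA a s))
    {δ : GProg M} {s s' : M.Sit} (h : δ.Do s s') (hs : Q s) : Q s' := by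
  obtain ⟨δ', hT, -⟩ := h
  have key : ∀ q : GProg M × M.Sit,
      Relation.ReflTransGen (fun p q : GProg M × M.Sit => p.1.Trans p.2 q.1 q.2) (δ, s) q →
      Q q.2 := by
    intro q hq
    induction hq with
    | refl => exact hs
    | tail _ hstep ih =>
      rcases hstep.sit with h | ⟨a, ha, h⟩
      · rwa [h]
      · rw [h]; exact hQ a _ ha ih
  exact key _ hT

end GProg

theorem actProg_do (M : SitStr σ O) (A : σ.Act) (x : Fin (σ.actArity A) → O) (s s' : M.Sit) :
    ((actProg L A).inst M x).Do s s' ↔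
      M.Poss (M.actFn A x) s ∧ s' = M.doA (M.actFn A x) s := by
  simp [actProg, Prog.inst, Term.eval, GProg.do_act]

/-! ### Extended regression -/

/-- `R^E[φ(s), δ]` says that some execution of `δ` in `s` ends in a situation where `φ` holds. -/
theorem BAT.eval_regE {D : BAT L σ} {M : SitStr σ O} (hM : D.IsModel M) {n : ℕ}
    (δ : Prog L σ n) (hδ : δ.IterFree) :
    ∀ (φ : Formula L σ 0 n) (s : M.Sit) (v : Fin n → O),
      (D.regE δ φ).eval M s Fin.elim0 v ↔
        ∃ s', (δ.inst M v).Do s s' ∧ φ.eval M s' Fin.elim0 v := by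
  induction δ with
  | act A ts =>
    intro φ s v
    simp [BAT.regE, Prog.inst, GProg.do_act, Formula.eval_subst, Formula.eval_regress hM,
      hM.pre, Formula.Holds, and_assoc]
  | test ψ =>
    intro φ s v
    simp [BAT.regE, Prog.inst, GProg.do_test, Formula.Holds, and_assoc]
  | seq δ₁ δ₂ ih₁ ih₂ =>
    intro φ s v
    simp only [BAT.regE, Prog.inst, GProg.do_seq, ih₁ hδ.1, ih₂ hδ.2]
    constructor
    · rintro ⟨t, h₁, s', h₂, h⟩
      exact ⟨s', ⟨t, h₁, h₂⟩, h⟩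
    · rintro ⟨s', ⟨t, h₁, h₂⟩, h⟩
      exact ⟨t, h₁, s', h₂, h⟩
  | choice δ₁ δ₂ ih₁ ih₂ =>
    intro φ s v
    simp only [BAT.regE, Prog.inst, GProg.do_choice, Formula.eval_disj, ih₁ hδ.1, ih₂ hδ.2,
      or_and_right, exists_or]
  | pick δ ih =>
    intro φ s v
    -- a block of one quantified variable is a function on `Fin 1`, hence constant
    have hw : ∀ w : Fin 1 → O, w = fun _ => w 0 := fun w => by
      funext i; rw [Subsingleton.elim i 0]
    simp only [BAT.regE, Prog.inst, GProg.do_pick, Formula.eval_ex, ih hδ, Formula.eval_wk]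
    constructor
    · rintro ⟨w, s', h, h'⟩
      rw [hw w] at h
      exact ⟨s', ⟨w 0, h⟩, h'⟩
    · rintro ⟨s', ⟨x, h⟩, h'⟩
      exact ⟨fun _ => x, s', h, h'⟩
  | star => exact hδ.elim

/-- `R^U[φ(s), δ]` says that every execution of `δ` in `s` ends in a situation where `φ` holds. -/
theorem BAT.eval_regU {D : BAT L σ} {M : SitStr σ O} (hM : D.IsModel M) {n : ℕ}
    (δ : Prog L σ n) (hδ : δ.IterFree) :
    ∀ (φ : Formula L σ 0 n) (s : M.Sit) (v : Fin n → O),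
      (D.regU δ φ).eval M s Fin.elim0 v ↔
        ∀ s', (δ.inst M v).Do s s' → φ.eval M s' Fin.elim0 v := by
  induction δ with
  | act A ts =>
    intro φ s v
    simp [BAT.regU, Prog.inst, GProg.do_act, Formula.eval_subst, Formula.eval_regress hM,
      hM.pre, Formula.Holds, Formula.eval]
  | test ψ =>
    intro φ s v
    simp [BAT.regU, Prog.inst, GProg.do_test, Formula.Holds, Formula.eval]
  | seq δ₁ δ₂ ih₁ ih₂ =>
    intro φ s v
    simp only [BAT.regU, Prog.inst, GProg.do_seq, ih₁ hδ.1, ih₂ hδ.2]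
    constructor
    · rintro H s' ⟨t, h₁, h₂⟩
      exact H t h₁ s' h₂
    · intro H t h₁ s' h₂
      exact H s' ⟨t, h₁, h₂⟩
  | choice δ₁ δ₂ ih₁ ih₂ =>
    intro φ s v
    simp only [BAT.regU, Prog.inst, GProg.do_choice, Formula.eval_conj, ih₁ hδ.1, ih₂ hδ.2,
      or_imp, forall_and]
  | pick δ ih =>
    intro φ s v
    -- a block of one quantified variable is a function on `Fin 1`, hence constant
    have hw : ∀ w : Fin 1 → O, w = fun _ => w 0 := fun w => by
      funext i; rw [Subsingleton.elim i 0]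
    simp only [BAT.regU, Prog.inst, GProg.do_pick, Formula.eval, ih hδ, Formula.eval_wk]
    constructor
    · rintro H s' ⟨x, h⟩
      exact H (fun _ => x) s' h
    · intro H w s' h
      rw [hw w] at h
      exact H s' ⟨w 0, h⟩
  | star => exact hδ.elim

theorem BAT.eval_execCond {D : BAT L σ} {M : SitStr σ O} (hM : D.IsModel M) (δ : Prog L σ n)
    (hδ : δ.IterFree) (s : M.Sit) (v : Fin n → O) :
    (D.execCond δ).eval M s Fin.elim0 v ↔ ∃ s', (δ.inst M v).Do s s' := by
  simp [BAT.execCond, BAT.eval_regE hM δ hδ]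

/-! ### The tree of situations -/

namespace SitStr

variable {M : SitStr σ O}

/-- `M.HasLength s n`: the situation `s` results from `S₀` by `n` actions. -/
inductive HasLength (M : SitStr σ O) : M.Sit → ℕ → Prop
  | S0 : HasLength M M.S0 0
  | doA {a : M.Act} {s : M.Sit} {n : ℕ} : HasLength M s n → HasLength M (M.doA a s) (n + 1)

namespace Foundational

theorem sit_induction (hM : M.Foundational) {Q : M.Sit → Prop} (S0 : Q M.S0)
    (doA : ∀ a s, Q s → Q (M.doA a s)) (s : M.Sit) : Q s :=
  hM.induction Q S0 doA s

theorem le_S0 (hM : M.Foundational) {s : M.Sit} (h : M.le s M.S0) : s = M.S0 :=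
  h.resolve_left (hM.not_lt_S0 s)

theorem le_do_iff (hM : M.Foundational) {s s' : M.Sit} {a : M.Act} :
    M.le s (M.doA a s') ↔ M.le s s' ∨ s = M.doA a s' := by
  rw [SitStr.le, hM.lt_do]

theorem do_ne_S0 (hM : M.Foundational) (a : M.Act) (s : M.Sit) : M.doA a s ≠ M.S0 := fun h =>
  hM.not_lt_S0 s (h ▸ (hM.lt_do a s s).2 (.inr rfl))

theorem le_trans (hM : M.Foundational) {s t u : M.Sit} (h : M.le s t) (h' : M.le t u) :
    M.le s u := by
  induction u using hM.sit_induction with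
  | S0 => exact hM.le_S0 h' ▸ h
  | doA a u ih =>
    rcases hM.le_do_iff.1 h' with h' | rfl
    · exact hM.le_do_iff.2 (.inl (ih h'))
    · exact h

theorem exec_do (hM : M.Foundational) {a : M.Act} {s : M.Sit} (ha : M.Poss a s) (hs : M.Exec s) :
    M.Exec (M.doA a s) := by
  intro b s' h
  rcases hM.le_do_iff.1 h with h | h
  · exact hs b s' h
  · obtain ⟨rfl, rfl⟩ := hM.do_inj _ _ _ _ h
    exact ha

theorem exec_S0 (hM : M.Foundational) : M.Exec M.S0 :=
  fun a s h => (hM.do_ne_S0 a s (hM.le_S0 h)).elim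

theorem length_unique (hM : M.Foundational) {s : M.Sit} {i j : ℕ} (hi : M.HasLength s i)
    (hj : M.HasLength s j) : i = j := by
  induction hi generalizing j with
  | S0 =>
    generalize hs : M.S0 = s at hj
    cases hj with
    | S0 => rfl
    | doA => exact (hM.do_ne_S0 _ _ hs.symm).elim
  | @doA a t n _ ih =>
    generalize hs : M.doA a t = s at hj
    cases hj with
    | S0 => exact (hM.do_ne_S0 _ _ hs).elim
    | doA h =>
      obtain ⟨-, rfl⟩ := hM.do_inj _ _ _ _ hs
      rw [ih h]

theorem length_le (hM : M.Foundational) {s u : M.Sit} {i j : ℕ} (h : M.le s u)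
    (hi : M.HasLength s i)
    (hj : M.HasLength u j) : i ≤ j := by
  induction hj with
  | S0 =>
    obtain rfl := hM.le_S0 h
    exact (hM.length_unique hi .S0).le
  | doA hu ih =>
    rcases hM.le_do_iff.1 h with h | rfl
    · exact (ih h).trans (Nat.le_succ _)
    · exact (hM.length_unique hi hu.doA).le

theorem exists_length (hM : M.Foundational) (s : M.Sit) : ∃ i, M.HasLength s i := by
  induction s using hM.sit_induction with
  | S0 => exact ⟨0, .S0⟩
  | doA a s ih => exact ih.imp' _ fun _ h => h.doA

/-- The predecessors of a situation are linearly ordered by their lengths. -/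
theorem eq_of_le_of_length (hM : M.Foundational) {s s' u : M.Sit} {i : ℕ}
    (h : M.le s u) (h' : M.le s' u)
    (hs : M.HasLength s i) (hs' : M.HasLength s' i) : s = s' := by
  induction u using hM.sit_induction with
  | S0 => rw [hM.le_S0 h, hM.le_S0 h']
  | doA a u ih =>
    obtain ⟨j, hj⟩ := hM.exists_length u
    rcases hM.le_do_iff.1 h with h | rfl <;> rcases hM.le_do_iff.1 h' with h' | rfl
    · exact ih h h'
    · have := hM.length_le h hs hj
      have := hM.length_unique hs' hj.doA
      omega
    · have := hM.length_le h' hs' hj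
      have := hM.length_unique hs hj.doA
      omega
    · rfl

/-- Every `⊑`-increasing sequence of situations lies on an infinite history. If the sequence is
eventually constant, the history is continued by arbitrary actions. -/
theorem exists_infHist (hM : M.Foundational) {t : ℕ → M.Sit} (ht : ∀ i, M.le (t i) (t (i + 1))) :
    ∃ h : InfHist M, ∀ i, h.Contains (t i) := by
  classical
  obtain ⟨a₀⟩ := M.act_nonempty
  have hmono : ∀ i d, M.le (t i) (t (i + d)) := fun i d => by
    induction d with
    | zero => exact .inr rfl
    | succ d ih => exact hM.le_trans ih (ht _)
  let I : M.Sit → Prop := fun s => ∃ i, M.le s (t i)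
  have hI : ∀ {s s' i}, I s → I s' → M.HasLength s i → M.HasLength s' i → s = s' := by
    rintro s s' i ⟨p, hp⟩ ⟨q, hq⟩ hs hs'
    refine hM.eq_of_le_of_length (hM.le_trans hp (hmono p q)) (hM.le_trans hq ?_) hs hs'
    rw [add_comm]
    exact hmono q p
  -- follow the prefixes of the sequence as long as possible
  let nxt : M.Sit → M.Act := fun s => if h : ∃ a, I (M.doA a s) then h.choose else a₀
  let seg : ℕ → M.Sit := fun i => Nat.rec M.S0 (fun _ s => M.doA (nxt s) s) i
  have hseg : ∀ s i, M.HasLength s i → I s → seg i = s := by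
    intro s i hs
    induction hs with
    | S0 => intro; rfl
    | @doA a s i hs ih =>
      rintro ⟨j, hj⟩
      have h : ∃ a, I (M.doA a s) := ⟨a, j, hj⟩
      have hsI : I s := ⟨j, hM.le_trans (hM.le_do_iff.2 (.inl (.inr rfl))) hj⟩
      change M.doA (nxt (seg i)) (seg i) = _
      rw [ih hsI]
      simp only [nxt, dif_pos h]
      exact hI h.choose_spec ⟨j, hj⟩ hs.doA hs.doA
  refine ⟨⟨seg, rfl, fun i => ⟨_, rfl⟩⟩, fun i => ?_⟩
  obtain ⟨j, hj⟩ := hM.exists_length (t i)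
  exact ⟨j, hseg _ _ hj ⟨i, .inr rfl⟩⟩

end Foundational

end SitStr

/-! ### Termination of programs without iteration -/

namespace GProg

variable {M : SitStr σ O}

/-- `δ.MaxActs n`: the program `δ` has no iteration and performs at most `n` actions. -/
def MaxActs : GProg M → ℕ → Prop
  | nil, _ => True
  | act _, n => 1 ≤ n
  | test _, _ => True
  | seq δ₁ δ₂, n => ∃ i j, i + j ≤ n ∧ δ₁.MaxActs i ∧ δ₂.MaxActs j
  | choice δ₁ δ₂, n => δ₁.MaxActs n ∧ δ₂.MaxActs n
  | pick δ, n => ∀ x, (δ x).MaxActs n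
  | star _, _ => False

theorem MaxActs.mono {δ : GProg M} {i j : ℕ} (h : δ.MaxActs i) (hij : i ≤ j) :
    δ.MaxActs j := by
  induction δ with
  | nil | test => trivial
  | act => exact h.trans hij
  | seq δ₁ δ₂ =>
    obtain ⟨p, q, hpq, h⟩ := h
    exact ⟨p, q, hpq.trans hij, h⟩
  | choice δ₁ δ₂ ih₁ ih₂ => exact ⟨ih₁ h.1, ih₂ h.2⟩
  | pick δ ih => exact fun x => ih x (h x)
  | star => exact h

/-- The action bound decreases with every action performed. -/
theorem MaxActs.trans {δ γ : GProg M} {s t : M.Sit} {n : ℕ} (hn : δ.MaxActs n)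
    (h : δ.Trans s γ t) :
    (t = s ∧ γ.MaxActs n) ∨ ∃ a i, n = i + 1 ∧ t = M.doA a s ∧ γ.MaxActs i := by
  induction δ generalizing γ n with
  | nil => exact h.elim
  | act α =>
    obtain ⟨-, rfl, rfl⟩ := h
    exact .inr ⟨_, n - 1, (Nat.sub_add_cancel hn).symm, rfl, trivial⟩
  | test φ =>
    obtain ⟨-, rfl, rfl⟩ := h
    exact .inl ⟨rfl, trivial⟩
  | seq δ₁ δ₂ ih₁ ih₂ =>
    obtain ⟨p, q, hpq, h₁, h₂⟩ := hn
    rcases h with ⟨γ, rfl, h⟩ | ⟨_, h⟩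
    · rcases ih₁ h₁ h with ⟨rfl, hγ⟩ | ⟨a, i, rfl, rfl, hγ⟩
      · exact .inl ⟨rfl, p, q, hpq, hγ, h₂⟩
      · exact .inr ⟨a, n - 1, by omega, rfl, i, q, by omega, hγ, h₂⟩
    · rcases ih₂ h₂ h with ⟨rfl, hγ⟩ | ⟨a, i, rfl, rfl, hγ⟩
      · exact .inl ⟨rfl, hγ.mono (by omega)⟩
      · exact .inr ⟨a, n - 1, by omega, rfl, hγ.mono (by omega)⟩
  | choice δ₁ δ₂ ih₁ ih₂ => exact h.elim (ih₁ hn.1) (ih₂ hn.2)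
  | pick δ ih => exact h.elim fun x h => ih x (hn x) h
  | star => exact hn.elim

theorem MaxActs.transStar {δ γ : GProg M} {s t : M.Sit} {n d : ℕ} (hn : δ.MaxActs n)
    (h : δ.TransStar s γ t) (hs : M.HasLength s d) : ∃ e ≤ d + n, M.HasLength t e := by
  have key : ∀ p : GProg M × M.Sit,
      Relation.ReflTransGen (fun p q : GProg M × M.Sit => p.1.Trans p.2 q.1 q.2) p (γ, t) →
      ∀ n d, p.1.MaxActs n → M.HasLength p.2 d → ∃ e ≤ d + n, M.HasLength t e := by
    intro p hp
    induction hp using Relation.ReflTransGen.head_induction_on with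
    | refl => exact fun n d _ hs => ⟨d, by omega, hs⟩
    | @head p q hpq hq ih =>
      intro n d hn hs
      rcases hn.trans hpq with ⟨h, hn'⟩ | ⟨a, i, rfl, h, hn'⟩
      · exact ih n d hn' (h ▸ hs)
      · obtain ⟨e, he, he'⟩ := ih i (d + 1) hn' (h ▸ hs.doA)
        exact ⟨e, by omega, he'⟩
  exact key _ h n d hn hs

end GProg

theorem Prog.IterFree.exists_maxActs (M : SitStr σ O) {n : ℕ} {δ : Prog L σ n}
    (hδ : δ.IterFree) : ∃ i, ∀ v, (δ.inst M v).MaxActs i := by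
  induction δ with
  | act => exact ⟨1, fun v => le_rfl⟩
  | test => exact ⟨0, fun v => trivial⟩
  | seq δ₁ δ₂ ih₁ ih₂ =>
    obtain ⟨i, hi⟩ := ih₁ hδ.1
    obtain ⟨j, hj⟩ := ih₂ hδ.2
    exact ⟨i + j, fun v => ⟨i, j, le_rfl, hi v, hj v⟩⟩
  | choice δ₁ δ₂ ih₁ ih₂ =>
    obtain ⟨i, hi⟩ := ih₁ hδ.1
    obtain ⟨j, hj⟩ := ih₂ hδ.2
    exact ⟨max i j, fun v => ⟨(hi v).mono (le_max_left i j), (hj v).mono (le_max_right i j)⟩⟩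
  | pick δ ih =>
    obtain ⟨i, hi⟩ := ih hδ
    exact ⟨i, fun v x => hi _⟩
  | star => exact hδ.elim

/-- The situations on an infinite history have unbounded lengths, but those that an iteration-free
program can reach have not. -/
theorem Prog.IterFree.terminates {M : SitStr σ O} (hM : M.Foundational) {δ : Prog L σ n}
    (hδ : δ.IterFree) (v : Fin n → O) (s : M.Sit) (C : TrajConstraint L σ) :
    (δ.inst M v).Terminates s C := by
  rintro ⟨h, -, ⟨i, rfl⟩, H⟩
  obtain ⟨j, hj⟩ := hδ.exists_maxActs M
  have hlen : ∀ i, M.HasLength (h.seg i) i := fun i => by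
    induction i with
    | zero => exact h.seg_zero ▸ .S0
    | succ i ih =>
      obtain ⟨a, ha⟩ := h.seg_succ i
      exact ha ▸ ih.doA
  have hle : ∀ d, M.le (h.seg i) (h.seg (i + d)) := fun d => by
    induction d with
    | zero => exact .inr rfl
    | succ d ih =>
      obtain ⟨a, ha⟩ := h.seg_succ (i + d)
      rw [← add_assoc, ha]
      exact hM.le_do_iff.2 (.inl ih)
  obtain ⟨γ, hγ⟩ := H _ ⟨i + (j + 1), rfl⟩ (hle (j + 1))
  obtain ⟨e, he, he'⟩ := (hj v).transStar hγ (hlen i)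
  have := hM.length_unique he' (hlen _)
  omega

/-! ### A model over a prescribed initial state -/

theorem suffix_and_ne_cons_iff {α : Type*} {a : α} {s s' : List α} :
    s <:+ a :: s' ∧ s ≠ a :: s' ↔ s <:+ s' := by
  rw [List.suffix_cons_iff]
  constructor
  · rintro ⟨h | h, h'⟩
    · exact (h' h).elim
    · exact h
  · intro h
    refine ⟨.inr h, ?_⟩
    rintro rfl
    simpa using h.length_le

/-- The values of all fluents in one situation. -/
structure FluentState (σ : Signature) (O : Type) where
  rel : (P : σ.Rel) → (Fin (σ.relArity P) → O) → Prop
  fn : (f : σ.Fn) → (Fin (σ.fnArity f) → O) → O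

/-- A fluent state as a structure with a single situation. The actions are the ground actions and
one additional unnamed action `none`, which keeps the sort of actions inhabited when there are no
action functions. -/
def FluentState.toSitStr (q : FluentState σ O) : SitStr σ O where
  Act := Option (GroundAct σ O)
  Sit := Unit
  act_nonempty := ⟨none⟩
  S0 := ()
  doA _ _ := ()
  lt _ _ := False
  Poss _ _ := False
  actFn A x := some ⟨A, x⟩
  rel P y _ := q.rel P y
  fn f y _ := q.fn f y

namespace BAT

/-- The state after the action `a`, by the successor state axioms. The value of a functional
fluent is chosen among those allowed by its axiom; it is arbitrary if there is none. -/
noncomputable def progress (D : BAT L σ) (a : Option (GroundAct σ O)) (q : FluentState σ O) :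
    FluentState σ O where
  rel P y := (D.ssaRel P).eval q.toSitStr () (fun _ => a) y
  fn f y :=
    haveI : Nonempty O := ⟨ObjectDomain.num L 0⟩
    Classical.epsilon fun z =>
      (D.ssaFn f).eval q.toSitStr () (fun _ => a) (Fin.append y (fun _ : Fin 1 => z))

/-- The state after a list of actions, the last action first. -/
noncomputable def stateAfter (D : BAT L σ) (q : FluentState σ O) :
    List (Option (GroundAct σ O)) → FluentState σ O
  | [] => q
  | a :: s => D.progress a (D.stateAfter q s)

/-- The structure generated by the initial state `q` and the axioms of `D`: situations are lists
of actions, the last action first. -/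
noncomputable def treeModel (D : BAT L σ) (q : FluentState σ O) : SitStr σ O where
  Act := Option (GroundAct σ O)
  Sit := List (Option (GroundAct σ O))
  act_nonempty := ⟨none⟩
  S0 := []
  doA a s := a :: s
  lt s s' := s <:+ s' ∧ s ≠ s'
  Poss a s := ∃ A x, a = some ⟨A, x⟩ ∧ (D.pre A).Holds (D.stateAfter q s).toSitStr () x
  actFn A x := some ⟨A, x⟩
  rel P y s := (D.stateAfter q s).rel P y
  fn f y s := (D.stateAfter q s).fn f y

theorem sameState_treeModel (D : BAT L σ) (q : FluentState σ O)
    (s : List (Option (GroundAct σ O))) :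
    SameState (D.treeModel q) (D.stateAfter q s).toSitStr id s () :=
  ⟨Function.injective_id, fun _ _ => rfl, fun _ _ => Iff.rfl, fun _ _ => rfl⟩

theorem treeModel_foundational (D : BAT L σ) (q : FluentState σ O) :
    (D.treeModel q).Foundational where
  do_inj a s a' s' h := List.cons.inj h
  induction Q h₀ h s := by
    induction s with
    | nil => exact h₀
    | cons a s ih => exact h a s ih
  not_lt_S0 s h := h.2 (List.suffix_nil.1 h.1)
  lt_do a s s' := by
    have hle : (D.treeModel q).le s s' ↔ s <:+ s' := by
      constructor
      · rintro (h | h)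
        · exact h.1
        · exact h ▸ List.suffix_refl _
      · intro h
        by_cases h' : s = s'
        · exact .inr h'
        · exact .inl ⟨h, h'⟩
    rw [hle]
    exact suffix_and_ne_cons_iff

theorem treeModel_uniqueNames (D : BAT L σ) (q : FluentState σ O) :
    (D.treeModel q).UniqueNames := fun _ _ h => Option.some.inj h

/-- The generated structure is a model as soon as it satisfies the initial knowledge base. -/
theorem treeModel_isModel {D : BAT L σ} (hD : D.FnConsistent) {q : FluentState σ O}
    (hq : ∀ φ ∈ D.initial, φ.HoldsAt (D.treeModel q) (D.treeModel q).S0) :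
    D.IsModel (D.treeModel q) where
  foundational := D.treeModel_foundational q
  uniqueNames := D.treeModel_uniqueNames q
  pre A x s := by
    have hs := ((D.sameState_treeModel q s).eval_formula Fin.elim0 (D.pre A) x)
    rw [Subsingleton.elim (fun i => id (Fin.elim0 i)) Fin.elim0] at hs
    refine Iff.trans ?_ hs.symm
    constructor
    · rintro ⟨A', x', h, h'⟩
      cases Option.some.inj h
      exact h'
    · exact fun h => ⟨A, x, rfl, h⟩
  ssaRel P y a s := ((D.sameState_treeModel q s).eval_formula (fun _ => a) (D.ssaRel P) y).symm
  ssaFn f y a s z := by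
    have : Nonempty O := ⟨ObjectDomain.num L 0⟩
    have hs := fun z => ((D.sameState_treeModel q s).eval_formula (fun _ => a) (D.ssaFn f)
      (Fin.append y (fun _ : Fin 1 => z)))
    have hex := hD O (D.treeModel q) (D.treeModel_uniqueNames q) hq f a s y
    have hval : (D.ssaFn f).eval (D.treeModel q) s (fun _ => a)
        (Fin.append y (fun _ : Fin 1 => (D.treeModel q).fn f y ((D.treeModel q).doA a s))) :=
      (hs _).2 (Classical.epsilon_spec (p := fun z =>
        (D.ssaFn f).eval (D.stateAfter q s).toSitStr () (fun _ => a)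
          (Fin.append y (fun _ : Fin 1 => z))) (hex.exists.imp fun z => (hs z).1))
    constructor
    · rintro rfl
      exact hval
    · exact fun h => hex.unique hval h
  initial := hq

end BAT

/-- The high-level fluent values in a low-level situation, read off from the refinement mapping. -/
noncomputable def RefMap.abstractState (r : RefMap L σh σl) (Ml : SitStr σl O) (s : Ml.Sit) :
    FluentState σh O where
  rel P y := (r.rel P).Holds Ml s y
  fn f y := (r.fn f).eval Ml s Fin.elim0 y

theorem mIso_treeModel (D : BAT L σh) (r : RefMap L σh σl) (Ml : SitStr σl O) (s : Ml.Sit) :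
    MIso r (D.treeModel (r.abstractState Ml s)) Ml (D.treeModel (r.abstractState Ml s)).S0 s :=
  ⟨fun _ _ => Iff.rfl, fun _ _ _ => Iff.rfl⟩

/-! ### One high-level action -/

/-- The verification conditions, read in a low-level situation `sl` satisfying the state
constraints: they make each high-level action agree with its refinement. -/
structure RefinesAt (r : RefMap L σh σl) (Dh : BAT L σh) (Dl : BAT L σl) (Ml : SitStr σl O)
    (sl : Ml.Sit) : Prop where
  xi : ∀ A x, (xiA r Dh Dl A).Holds Ml sl x
  rel : ∀ A P x, (zetaRel r Dh Dl A P).Holds Ml sl x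
  fn : ∀ A f x, (zetaFn r Dh Dl A f).Holds Ml sl x

section Step

variable {r : RefMap L σh σl} {Dh : BAT L σh} {Dl : BAT L σl} {Mh : SitStr σh O}
  {Ml : SitStr σl O} {sh : Mh.Sit} {sl sl' : Ml.Sit}

/-- A high-level action is possible exactly if its refinement has an execution. -/
theorem RefinesAt.poss_iff (H : RefinesAt r Dh Dl Ml sl) (hMh : Dh.IsModel Mh)
    (hMl : Dl.IsModel Ml) (hr : ∀ A, (r.act A).IterFree) (hs : MIso r Mh Ml sh sl) (A : σh.Act)
    (x : Fin (σh.actArity A) → O) :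
    Mh.Poss (Mh.actFn A x) sh ↔ ∃ sl', ((r.act A).inst Ml x).Do sl sl' := by
  have h := H.xi A x
  rw [xiA, Formula.Holds, Formula.eval_iff, BAT.eval_execCond hMl _ (hr A),
    hs.eval_formula_map] at h
  rw [hMh.pre, h]
  rfl

/-- The conditions on `R^E` and `R^U` together determine the truth value of `φ` after every
execution of an executable program. -/
theorem BAT.eval_iff_of_regE_regU {D : BAT L σ} {M : SitStr σ O} (hM : D.IsModel M)
    {δ : Prog L σ n} (hδ : δ.IterFree) {φ χ : Formula L σ 0 n} {s s' : M.Sit} {v : Fin n → O}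
    (hE : (D.regE δ φ).eval M s Fin.elim0 v → χ.eval M s Fin.elim0 v)
    (hU : χ.eval M s Fin.elim0 v → (D.regU δ φ).eval M s Fin.elim0 v)
    (h : (δ.inst M v).Do s s') : χ.eval M s Fin.elim0 v ↔ φ.eval M s' Fin.elim0 v :=
  ⟨fun hχ => (BAT.eval_regU hM δ hδ φ s v).1 (hU hχ) s' h,
    fun hφ => hE ((BAT.eval_regE hM δ hδ φ s v).2 ⟨s', h, hφ⟩)⟩

/-- Every execution of the refinement preserves `m`-isomorphism. -/
theorem RefinesAt.mIso_do (H : RefinesAt r Dh Dl Ml sl) (hMh : Dh.IsModel Mh)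
    (hMl : Dl.IsModel Ml) (hr : ∀ A, (r.act A).IterFree) (hs : MIso r Mh Ml sh sl) {A : σh.Act}
    {x : Fin (σh.actArity A) → O} (h : ((r.act A).inst Ml x).Do sl sl') :
    MIso r Mh Ml (Mh.doA (Mh.actFn A x) sh) sl' := by
  have hpre := (BAT.eval_execCond hMl _ (hr A) sl x).2 ⟨sl', h⟩
  constructor
  · intro P y
    have hz := H.rel A P x
    simp only [zetaRel, Formula.Holds, Formula.eval, Formula.eval_conj] at hz
    obtain ⟨hE, hU⟩ := hz hpre y
    have := BAT.eval_iff_of_regE_regU hMl ((hr A).rename _) hE hU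
      (s' := sl') ((Prog.inst_wk Ml (r.act A) x y).symm ▸ h)
    rw [hs.eval_formula_map, BAT.eval_ssaRelAt _ hMh.uniqueNames, ← hMh.ssaRel,
      Formula.eval_rename] at this
    simpa [Formula.Holds] using this
  · intro f y z
    have hz := H.fn A f x
    simp only [zetaFn, Formula.Holds, Formula.eval, Formula.eval_conj] at hz
    obtain ⟨hE, hU⟩ := hz hpre (Fin.append y (fun _ : Fin 1 => z))
    have := BAT.eval_iff_of_regE_regU hMl ((hr A).rename _) hE hU
      (s' := sl') ((Prog.inst_wk Ml (r.act A) x (Fin.append y (fun _ : Fin 1 => z))).symm ▸ h)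
    rw [hs.eval_formula_map, BAT.eval_ssaFnAt _ hMh.uniqueNames, ← hMh.ssaFn,
      Formula.eval_rename] at this
    simpa [Formula.eval, Term.eval] using this

end Step

/-! ### The simulation relation -/

/-- The situations reached by executing the same high-level actions in `Mh` and, through their
refinements, in `Ml`. -/
inductive LockStep (r : RefMap L σh σl) (Mh : SitStr σh O) (Ml : SitStr σl O) :
    Mh.Sit → Ml.Sit → Prop
  | start : LockStep r Mh Ml Mh.S0 Ml.S0
  | step {sh : Mh.Sit} {sl sl' : Ml.Sit} (A : σh.Act) (x : Fin (σh.actArity A) → O) :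
      LockStep r Mh Ml sh sl → Mh.Poss (Mh.actFn A x) sh →
      ((r.act A).inst Ml x).Do sl sl' →
      LockStep r Mh Ml (Mh.doA (Mh.actFn A x) sh) sl'

section Simulation

variable {r : RefMap L σh σl} {Dh : BAT L σh} {Dl : BAT L σl} {Mh : SitStr σh O}
  {Ml : SitStr σl O} {Ch : TrajConstraint L σh} {Cl : TrajConstraint L σl}

theorem LockStep.mIso_and_exec (hMh : Dh.IsModel Mh) (hMl : Dl.IsModel Ml)
    (hr : ∀ A, (r.act A).IterFree) (H : ∀ sl, Ml.Exec sl → RefinesAt r Dh Dl Ml sl)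
    (h₀ : MIso r Mh Ml Mh.S0 Ml.S0) {sh : Mh.Sit} {sl : Ml.Sit} (h : LockStep r Mh Ml sh sl) :
    MIso r Mh Ml sh sl ∧ Ml.Exec sl := by
  induction h with
  | start => exact ⟨h₀, hMl.foundational.exec_S0⟩
  | step A x _ _ hdo ih =>
    exact ⟨(H _ ih.2).mIso_do hMh hMl hr ih.1 hdo,
      hdo.preserves (fun a s => hMl.foundational.exec_do) ih.2⟩

/-- The high-level counterpart of a low-level run is determined by the sequence of actions. -/
theorem lockStep_isSimulation (hMh : Dh.IsModel Mh) (hMl : Dl.IsModel Ml)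
    (hr : ∀ A, (r.act A).IterFree) (H : ∀ sl, Ml.Exec sl → RefinesAt r Dh Dl Ml sl)
    (h₀ : MIso r Mh Ml Mh.S0 Ml.S0) (hCh : ∀ h : InfHist Mh, Ch.HoldsOn h) :
    IsSimulation r Ch Cl Mh Ml (LockStep r Mh Ml) := by
  have hinv {sh sl} (h : LockStep r Mh Ml sh sl) := h.mIso_and_exec hMh hMl hr H h₀
  have hposs : ∀ {sh sl sl'} (A x), LockStep r Mh Ml sh sl →
      ((r.act A).inst Ml x).Do sl sl' → Mh.Poss (Mh.actFn A x) sh := fun A x h hdo =>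
    ((H _ (hinv h).2).poss_iff hMh hMl hr (hinv h).1 A x).2 ⟨_, hdo⟩
  refine ⟨.start, fun _ _ h => (hinv h).1,
    fun _ sl _ A x => (hr A).terminates hMl.foundational x sl Cl, ?_, ?_⟩
  · intro sh sl h A x sl' hdo
    exact ⟨_, (actProg_do Mh A x _ _).2 ⟨hposs A x h hdo, rfl⟩, h.step A x (hposs A x h hdo) hdo⟩
  · rintro ω ⟨_, ⟨t, ht₀, ht⟩, -⟩
    let u : ℕ → Mh.Sit := fun i =>
      Nat.rec Mh.S0 (fun i s => Mh.doA (Mh.actFn (ω i).1 (ω i).2) s) i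
    have hu : ∀ i, LockStep r Mh Ml (u i) (t i) := fun i => by
      induction i with
      | zero => rw [ht₀]; exact .start
      | succ i ih => exact ih.step _ _ (hposs _ _ ih (ht i).1) (ht i).1
    refine ⟨⟨u, rfl, fun i => ⟨_, rfl⟩⟩, ⟨u, rfl, fun i => ⟨?_, i, rfl⟩⟩, hCh _⟩
    exact (actProg_do Mh _ _ _ _).2 ⟨hposs _ _ (hu i) (ht i).1, rfl⟩

/-- The low-level counterpart of a high-level run is built by choosing an execution of the
refinement for each action in turn; a history through its situations exists although they need not be
distinct. -/
theorem lockStep_isBackSimulation (hMh : Dh.IsModel Mh) (hMl : Dl.IsModel Ml)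
    (hr : ∀ A, (r.act A).IterFree) (H : ∀ sl, Ml.Exec sl → RefinesAt r Dh Dl Ml sl)
    (h₀ : MIso r Mh Ml Mh.S0 Ml.S0) (hCl : ∀ h : InfHist Ml, Cl.HoldsOn h) :
    IsBackSimulation r Ch Cl Mh Ml (LockStep r Mh Ml) := by
  have hinv {sh sl} (h : LockStep r Mh Ml sh sl) := h.mIso_and_exec hMh hMl hr H h₀
  have hstep : ∀ A x {sh sl sh'}, LockStep r Mh Ml sh sl →
      ((actProg L A).inst Mh x).Do sh sh' →
      ∃ sl', ((r.act A).inst Ml x).Do sl sl' ∧ LockStep r Mh Ml sh' sl' := by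
    intro A x sh sl sh' h hdo
    obtain ⟨hp, rfl⟩ := (actProg_do Mh A x _ _).1 hdo
    obtain ⟨sl', hdo'⟩ := ((H _ (hinv h).2).poss_iff hMh hMl hr (hinv h).1 A x).1 hp
    exact ⟨sl', hdo', h.step A x hp hdo'⟩
  refine ⟨.start, fun _ _ h => (hinv h).1,
    fun _ sl _ A x => (hr A).terminates hMl.foundational x sl Cl,
    fun sh sl h A x sh' => hstep A x h, ?_⟩
  rintro ω ⟨_, ⟨t, ht₀, ht⟩, -⟩
  have hnext : ∀ i sl, ∃ sl', LockStep r Mh Ml (t i) sl →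
      ((r.act (ω i).1).inst Ml (ω i).2).Do sl sl' ∧ LockStep r Mh Ml (t (i + 1)) sl' := by
    intro i sl
    by_cases h : LockStep r Mh Ml (t i) sl
    · exact (hstep _ _ h (ht i).1).imp fun _ h _ => h
    · exact ⟨sl, fun h' => (h h').elim⟩
  choose nxt hnxt using hnext
  let u : ℕ → Ml.Sit := fun i => Nat.rec Ml.S0 nxt i
  have hu : ∀ i, LockStep r Mh Ml (t i) (u i) := fun i => by
    induction i with
    | zero => rw [ht₀]; exact .start
    | succ i ih => exact (hnxt i _ ih).2
  have hdo : ∀ i, ((r.act (ω i).1).inst Ml (ω i).2).Do (u i) (u (i + 1)) :=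
    fun i => (hnxt i _ (hu i)).1
  have hle : ∀ i, Ml.le (u i) (u (i + 1)) := fun i =>
    (hdo i).preserves (Q := fun s => Ml.le (u i) s)
      (fun a s _ h => hMl.foundational.le_do_iff.2 (.inl h)) (.inr rfl)
  obtain ⟨h, hh⟩ := hMl.foundational.exists_infHist hle
  exact ⟨h, ⟨u, rfl, fun i => ⟨hdo i, hh i⟩⟩, hCl h⟩

end Simulation

end SitCalc

theorem mainTheorem3 {L : FirstOrder.Language.{0, 0}} {σh σl : Signature}
    (Gh : GPlanning L σh) (Gl : GPlanning L σl) (r : RefMap L σh σl)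
    (Dsc : Set (SitCalc.Formula L σl 0 0))
    (hsc : ∀ φ ∈ Dsc, BAT.IsStateConstraint Gl.bat φ)
    (hfn : BAT.FnConsistent Gh.bat)
    (hCh : GPlanning.TrivialConstraint Gh)
    (hCl : GPlanning.TrivialConstraint Gl)
    (hiter : ∀ A : σh.Act, (r.act A).IterFree)
    (h₁ : ∀ φ ∈ Gh.bat.initial, FOEntailsInit Gl.bat.initial (φ.map r))
    (h₂ : ∀ A : σh.Act, FOEntails Dsc (xiA r Gh.bat Gl.bat A))
    (h₃ : ∀ A : σh.Act,
      (∀ P : σh.Rel, FOEntails Dsc (zetaRel r Gh.bat Gl.bat A P)) ∧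
      (∀ f : σh.Fn, FOEntails Dsc (zetaFn r Gh.bat Gl.bat A f)))
    (h₄ : FOEntails Dsc ((Gh.goal.map r).imp Gl.goal)) :
    SoundAbstraction r Gh Gl := by
  have key : ∀ (O : Type) [ObjectDomain L O] (Ml : SitStr σl O), Gl.bat.IsModel Ml →
      ∃ Mh : SitStr σh O, Gh.bat.IsModel Mh ∧
        IsBackSimulation r Gh.constraint Gl.constraint Mh Ml (LockStep r Mh Ml) ∧
        IsSimulation r Gh.constraint Gl.constraint Mh Ml (LockStep r Mh Ml) ∧
        ∀ sh sl, LockStep r Mh Ml sh sl → Gh.goal.HoldsAt Mh sh → Gl.goal.HoldsAt Ml sl := by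
    intro O _ Ml hMl
    have h₀ := mIso_treeModel Gh.bat r Ml Ml.S0
    have hMh := BAT.treeModel_isModel hfn (q := r.abstractState Ml Ml.S0) fun φ hφ =>
      (h₀.eval_formula_map φ _).1 (h₁ φ hφ O Ml hMl.initial)
    have hDsc : ∀ sl, Ml.Exec sl → ∀ γ ∈ Dsc, γ.HoldsAt Ml sl := fun sl hsl γ hγ =>
      hsc γ hγ O Ml hMl sl hsl
    have H : ∀ sl, Ml.Exec sl → RefinesAt r Gh.bat Gl.bat Ml sl := fun sl hsl =>
      ⟨fun A => h₂ A O Ml sl (hDsc sl hsl), fun A P => (h₃ A).1 P O Ml sl (hDsc sl hsl),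
        fun A f => (h₃ A).2 f O Ml sl (hDsc sl hsl)⟩
    refine ⟨_, hMh, lockStep_isBackSimulation hMh hMl hiter H h₀ (hCl O Ml hMl),
      lockStep_isSimulation hMh hMl hiter H h₀ (hCh O _ hMh), fun sh sl hB hG => ?_⟩
    obtain ⟨hiso, hsl⟩ := hB.mIso_and_exec hMh hMl hiter H h₀
    exact h₄ O Ml sl (hDsc sl hsl) _ ((hiso.eval_formula_map Gh.goal _).2 hG)
  constructor
  · intro O _ Ml hMl
    obtain ⟨Mh, hMh, hB, -, hG⟩ := key O Ml hMl
    exact ⟨Mh, hMh, _, hB, hG⟩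
  · intro O _ Ml hMl
    obtain ⟨Mh, hMh, -, hB, hG⟩ := key O Ml hMl
    exact ⟨Mh, hMh, _, hB, hG⟩
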